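/- **Setting.** Let $d\in\{2,3\}$, $k\ge 1$, and let $\Omega\subset\mathbb R^d$ be a bounded open set (for instance a polyhedral Lipschitz domain) with boundary $\Gamma$ and a conforming simplicial triangulation $\mathcal T_\Omega$, i.e., $\overline\Omega$ is the union of its $d$-simplices and $\Gamma$ is the union of those $(d-1)$-dimensional faces that lie on $\Gamma$. Let $h$ be the maximal diameter of the $d$-simplices, and suppose that $\mathcal T_\Omega$ is quasi-uniform with parameter $\sigma>0$: every $d$-simplex contains a ball of radius $\sigma h$. Let $\alpha\in L^\infty(\Omega)$ and $\kappa\in L^\infty(\Gamma)$ be uniformly positive, with $\alpha\le\alpha_{\max}$ a.e. Let $\mathbb V_h$ be the space of continuous piecewise polynomials of degree at most $k$ on $\mathcal T_\Omega$, with Lagrange nodal basis $(\varphi_i)_{i\le N_u}$, the nodes being ordered such that the $N_\lambda$ nodes on $\Gamma$ come last; let $\mathbb M_h=\mathbb V_h|_\Gamma$ with basis $\psi_i=\varphi_{N_u-N_\lambda+i}|_\Gamma$, $i\le N_\lambda$; and let $\mathbb Q_h$ be a space of continuous piecewise polynomials on a triangulation of $\Gamma$, with basis $(q_j)_{j\le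 N_p}$. Define $$(M_u)_{ij}=\int_\Omega\varphi_i\varphi_j,\quad (K_u)_{ij}=\int_\Omega\alpha\nabla\varphi_i\cdot\nabla\varphi_j,\quad (M_p)_{ij}=\int_\Gamma q_iq_j,\quad (K_p)_{ij}=\int_\Gamma\kappa\nabla_\Gamma q_i\cdot\nabla_\Gamma q_j,$$ $$(M_\lambda)_{ij}=\int_\Gamma\psi_i\psi_j,\quad (B_u)_{ij}=\int_\Gamma\psi_i\varphi_j,\quad (B_p)_{ij}=\int_\Gamma\psi_iq_j .$$ Coefficient vectors $u\in\mathbb R^{N_u}$ are split into $u=(u_1,u_2)$ with $u_2\in\mathbb R^{N_\lambda}$; $M_{ij}$ and $K_{ij}$, $i,j\in\{1,2\}$, denote the corresponding blocks of $M_u$ and $K_u$. Write $\|x\|_A^2=x^TAx$. For $\tau>0$ put $$Ex^n=x^n-x^{n-1},\quad D_\tau x^n=\tfrac1{2\tau}(3x^n-4x^{n-1}+x^{n-2}),\quad \widetilde D_\tau x^n=\tfrac1{2\tau}(5x^{n-1}-8x^{n-2}+3x^{n-3}).$$ Let $u^{-1},u^0\in\mathbb R^{N_u}$ and $p^{-2},p^{-1},p^0\in\mathbb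 R^{N_p}$ be consistent initial data, i.e., $B_uu^j=B_pp^j$ for $j=-1,0$, set $\hat u^{-1}=u^{-1}$, $\hat u^0=u^0$, let $f_u^n=(f_1^n,f_2^n)\in\mathbb R^{N_u}$ and $f_p^n\in\mathbb R^{N_p}$, $n\ge1$, be arbitrary right-hand sides, and let $(\hat u^n,p^n,\lambda^n)$, $n\ge1$, satisfy the auxiliary scheme $$\begin{aligned} M_{11}D_\tau\hat u_1^n+K_{11}\hat u_1^n&=f_1^n-M_{12}M_\lambda^{-1}B_p\widetilde D_\tau p^n-K_{12}M_\lambda^{-1}B_p(2p^{n-1}-p^{n-2}),\\ M_{21}D_\tau\hat u_1^n+K_{21}\hat u_1^n-M_\lambda\lambda^n&=f_2^n-M_{22}M_\lambda^{-1}B_p\widetilde D_\tau p^n-K_{22}M_\lambda^{-1}B_p(2p^{n-1}-p^{n-2}),\\ M_pD_\tau p^n+K_pp^n+B_p^T\lambda^n&=f_p^n,\qquad M_\lambda\hat u_2^n=B_pp^n . \end{aligned}$$ **Proposition (stability of the auxiliary scheme).** There are constants $c_M>0$, depending only on $d,k,\sigma$, and $c_K,h_0,C>0$, depending only on $d,k,\sigma,\alpha_{\max}$,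 such that in the above setting the following holds. (i) If $B_uu=B_pp$ for some $u\in\mathbb R^{N_u}$, $p\in\mathbb R^{N_p}$, then $\|u_2\|_{M_{22}}^2\le c_Mh\,\|p\|_{M_p}^2$ and $\|u_2\|_{K_{22}}^2\le c_Kh^{-1}\|p\|_{M_p}^2$. (ii) For all $n\ge-2$, $$\begin{aligned} &\|\hat u^{n+3}\|_{K_u}^2+\|p^{n+3}\|_{K_p}^2+\tau\sum_{j=1}^{n+3}\Big(\|\tfrac1\tau E\hat u^j\|_{M_u}^2+\|\tfrac1\tau Ep^j\|_{M_p}^2+\tfrac12\|\tfrac1\tau E^2\hat u^j\|_{M_u}^2\Big)\\ &\qquad+\tau\sum_{j=1}^{n+3}\big(\tfrac12-18c_Mh-c_K\tau h^{-1}\big)\|\tfrac1\tau E^2p^j\|_{M_p}^2+\sum_{j=1}^{n+3}\|Ep^j\|_{K_p}^2\\ &\le\|u^0\|_{K_u}^2+\|p^0\|_{K_p}^2+\tfrac\tau2\|\tfrac1\tau Eu^0\|_{M_u}^2+\tfrac\tau2\|\tfrac1\tau Ep^0\|_{M_p}^2+9c_M\tau h\,\|\tfrac1\tau E^2p^0\|_{M_p}^2\\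 &\qquad+2\tau\sum_{j=1}^{n+3}\Big(\|f_u^j\|_{M_u^{-1}}^2+\|f_p^j\|_{M_p^{-1}}^2\Big). \end{aligned}$$ (iii) If $h\le h_0$ and $\tau\le Ch$, then $\tfrac12-18c_Mh-c_K\tau h^{-1}\ge0$, and hence the estimate in (ii) remains true, for all $n\ge-2$, when the terms with $\|\tfrac1\tau E^2p^j\|_{M_p}^2$, $j\ge1$, are omitted. -/

import Mathlib

open MeasureTheory Matrix

/-- `ℝ^d` with the Euclidean norm. -/
abbrev Euc (d : ℕ) : Type := EuclideanSpace ℝ (Fin d)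

/-- The simplex with vertex set `s`, as a subset of `ℝ^d`. -/
def simplexHull {d : ℕ} (s : Finset (Euc d)) : Set (Euc d) := convexHull ℝ (s : Set (Euc d))

/-- `v` coincides on `S` with a polynomial of total degree at most `k`. -/
def IsPolyOn {d : ℕ} (k : ℕ) (v : Euc d → ℝ) (S : Set (Euc d)) : Prop :=
  ∃ P : MvPolynomial (Fin d) ℝ, P.totalDegree ≤ k ∧
    ∀ x ∈ S, v x = MvPolynomial.eval (fun i => x i) P

/-- Membership in the conforming Lagrange space `𝒫_k` of a simplicial complex: continuous on the
underlying set and polynomial of degree at most `k` on every simplex. -/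
def InLagrangeSpace {d : ℕ} (K : Geometry.SimplicialComplex ℝ (Euc d)) (k : ℕ)
    (v : Euc d → ℝ) : Prop :=
  ContinuousOn v K.space ∧ ∀ s ∈ K.faces, IsPolyOn k v (simplexHull s)

/-- The Lagrange nodes of order `k`: the points with barycentric coordinates in `(1/k) ℕ` with
respect to some simplex of the complex. -/
def lagrangeNodes {d : ℕ} (K : Geometry.SimplicialComplex ℝ (Euc d)) (k : ℕ) : Set (Euc d) :=
  {x | ∃ s ∈ K.faces, ∃ m : Euc d → ℕ, ∑ a ∈ s, m a = k ∧
    x = ∑ a ∈ s, ((m a : ℝ) / (k : ℝ)) • a}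

/-- The tangential gradient of `p` at a point `x` of the flat simplex `s`: the gradient of `p`,
viewed near `x` as a function on the part of the tangent space of `s` that parametrizes `s`. -/
noncomputable def tangentialGradient {d : ℕ} (s : Finset (Euc d)) (p : Euc d → ℝ) (x : Euc d) :
    vectorSpan ℝ (s : Set (Euc d)) :=
  gradientWithin (fun v : vectorSpan ℝ (s : Set (Euc d)) => p (x + (v : Euc d)))
    {v | x + (v : Euc d) ∈ simplexHull s} 0

/-- Conforming bulk--surface finite element discretization in `ℝ^d` with Lagrange elements of
degree `k` in the bulk.

The bulk domain is `Ω`, with boundary `Γ = frontier Ω`.  The space `V_h` is the Lagrange space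
`𝒫_k` of a triangulation of `Ω`, with its nodal basis ordered such that interior nodes come first.
The space `M_h` of the multipliers is the space of traces of `V_h`, with the traces of the basis
functions of the boundary nodes as its basis.  The space `Q_h` is any space of continuous
piecewise polynomials on a second triangulation of `Γ`. -/
structure BulkSurfaceFE (d k : ℕ) where
  /-- the bulk domain -/
  Ω : Set (Euc d)
  isOpen_Ω : IsOpen Ω
  /-- the triangulation of the bulk -/
  bulkMesh : Geometry.SimplicialComplex ℝ (Euc d)
  finite_bulkMesh : bulkMesh.faces.Finite
  pure_bulkMesh : ∀ s ∈ bulkMesh.faces, ∃ t ∈ bulkMesh.faces, s ⊆ t ∧ t.card = d + 1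
  space_bulkMesh : bulkMesh.space = closure Ω
  /-- the `(d-1)`-dimensional mesh simplices contained in the boundary triangulate the boundary -/
  boundary_bulkMesh : frontier Ω =
    ⋃ s ∈ {s | s ∈ bulkMesh.faces ∧ s.card = d ∧ simplexHull s ⊆ frontier Ω}, simplexHull s
  /-- the number of interior nodes, which is `N_u - N_λ` -/
  NI : ℕ
  /-- the number of boundary nodes, which is `N_λ` -/
  NB : ℕ
  /-- the enumeration of the Lagrange nodes -/
  node : Fin NI ⊕ Fin NB → Euc d
  node_injective : Function.Injective node
  range_node_inl : Set.range (fun i => node (Sum.inl i)) = lagrangeNodes bulkMesh k \ frontier Ω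
  range_node_inr : Set.range (fun i => node (Sum.inr i)) = lagrangeNodes bulkMesh k ∩ frontier Ω
  /-- the nodal basis of `V_h` -/
  φ : Fin NI ⊕ Fin NB → Euc d → ℝ
  φ_mem : ∀ i, InLagrangeSpace bulkMesh k (φ i)
  φ_node : ∀ i j, φ i (node j) = if i = j then 1 else 0
  /-- the triangulation of the boundary that belongs to `Q_h` -/
  surfMesh : Geometry.SimplicialComplex ℝ (Euc d)
  finite_surfMesh : surfMesh.faces.Finite
  pure_surfMesh : ∀ s ∈ surfMesh.faces, ∃ t ∈ surfMesh.faces, s ⊆ t ∧ t.card = d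
  space_surfMesh : surfMesh.space = frontier Ω
  /-- a bound on the polynomial degree in `Q_h` -/
  ℓ : ℕ
  /-- the dimension of `Q_h` -/
  Np : ℕ
  /-- the basis of `Q_h` -/
  q : Fin Np → Euc d → ℝ
  q_mem : ∀ j, InLagrangeSpace surfMesh ℓ (q j)
  q_indep : LinearIndependent ℝ (fun j => (frontier Ω).domRestrict (q j))
  /-- the diffusion coefficient in the bulk -/
  α : Euc d → ℝ
  aesm_α : AEStronglyMeasurable α (volume.restrict Ω)
  bounds_α : ∃ a₀ > 0, ∃ a₁, ∀ᵐ x ∂(volume.restrict Ω), a₀ ≤ α x ∧ α x ≤ a₁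
  /-- the diffusion coefficient on the boundary -/
  κ : Euc d → ℝ
  aesm_κ : AEStronglyMeasurable κ (μHE[d - 1].restrict (frontier Ω))
  bounds_κ : ∃ b₀ > 0, ∃ b₁, ∀ᵐ x ∂(μHE[d - 1].restrict (frontier Ω)), b₀ ≤ κ x ∧ κ x ≤ b₁

namespace BulkSurfaceFE

variable {d k : ℕ} (D : BulkSurfaceFE d k)

/-- The boundary of the domain. -/
def Γ : Set (Euc d) := frontier D.Ω

/-- The surface measure, i.e., the Euclidean `(d-1)`-dimensional Hausdorff measure on `Γ`. -/
noncomputable def surf : Measure (Euc d) := μHE[d - 1].restrict D.Γ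

/-- The `d`-dimensional simplices of the triangulation of the bulk. -/
def cells : Set (Finset (Euc d)) := {s | s ∈ D.bulkMesh.faces ∧ s.card = d + 1}

/-- The maximal mesh width of the triangulation of the bulk. -/
noncomputable def h : ℝ := sSup ((fun s => Metric.diam (simplexHull s)) '' D.cells)

/-- Quasi-uniformity with uniformity parameter `σ`: every cell contains a ball of radius `σ h`. -/
def QuasiUniform (σ : ℝ) : Prop :=
  ∀ s ∈ D.cells, ∃ c, Metric.closedBall c (σ * D.h) ⊆ simplexHull s

/-- The facets of the triangulation of the boundary that belongs to `Q_h`. -/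
noncomputable def surfFacets : Finset (Finset (Euc d)) :=
  D.finite_surfMesh.toFinset.filter (fun s => s.card = d)

/-- The bulk mass matrix. -/
noncomputable def Mu : Matrix (Fin D.NI ⊕ Fin D.NB) (Fin D.NI ⊕ Fin D.NB) ℝ :=
  Matrix.of fun i j => ∫ x in D.Ω, D.φ i x * D.φ j x

/-- The bulk stiffness matrix. -/
noncomputable def Ku : Matrix (Fin D.NI ⊕ Fin D.NB) (Fin D.NI ⊕ Fin D.NB) ℝ :=
  Matrix.of fun i j => ∫ x in D.Ω, D.α x * inner ℝ (gradient (D.φ i) x) (gradient (D.φ j) x)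

/-- The surface mass matrix. -/
noncomputable def Mp : Matrix (Fin D.Np) (Fin D.Np) ℝ :=
  Matrix.of fun i j => ∫ x, D.q i x * D.q j x ∂D.surf

/-- The surface stiffness matrix. -/
noncomputable def Kp : Matrix (Fin D.Np) (Fin D.Np) ℝ :=
  Matrix.of fun i j => ∑ s ∈ D.surfFacets, ∫ x in simplexHull s,
    D.κ x * inner ℝ (tangentialGradient s (D.q i) x) (tangentialGradient s (D.q j) x) ∂μHE[d - 1]

/-- The mass matrix of the multiplier space `M_h`. -/
noncomputable def Mlam : Matrix (Fin D.NB) (Fin D.NB) ℝ :=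
  Matrix.of fun i j => ∫ x, D.φ (Sum.inr i) x * D.φ (Sum.inr j) x ∂D.surf

/-- The matrix of the trace operator on `V_h`, tested with `M_h`. -/
noncomputable def Bu : Matrix (Fin D.NB) (Fin D.NI ⊕ Fin D.NB) ℝ :=
  Matrix.of fun i j => ∫ x, D.φ (Sum.inr i) x * D.φ j x ∂D.surf

/-- The matrix of the embedding of `Q_h`, tested with `M_h`. -/
noncomputable def Bp : Matrix (Fin D.NB) (Fin D.Np) ℝ :=
  Matrix.of fun i j => ∫ x, D.φ (Sum.inr i) x * D.q j x ∂D.surf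

end BulkSurfaceFE

/-- The squared norm `xᵀ A x`. -/
def sqNorm {ι : Type} [Fintype ι] (A : Matrix ι ι ℝ) (x : ι → ℝ) : ℝ := x ⬝ᵥ (A *ᵥ x)

/-- The difference of two consecutive members of a sequence, `x^n - x^{n-1}`. -/
def bdiff {ι : Type} (x : ℤ → ι → ℝ) (n : ℤ) : ι → ℝ := x n - x (n - 1)

/-- The BDF-2 difference quotient, `(3 x^n - 4 x^{n-1} + x^{n-2}) / (2τ)`. -/
noncomputable def bdf2 {ι : Type} (τ : ℝ) (x : ℤ → ι → ℝ) (n : ℤ) : ι → ℝ :=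
  (1 / (2 * τ)) • ((3 : ℝ) • x n - (4 : ℝ) • x (n - 1) + x (n - 2))

/-- The explicit difference quotient `(5 x^{n-1} - 8 x^{n-2} + 3 x^{n-3}) / (2τ)`, which
approximates the derivative at the `n`-th time point. -/
noncomputable def delayQuotient {ι : Type} (τ : ℝ) (x : ℤ → ι → ℝ) (n : ℤ) : ι → ℝ :=
  (1 / (2 * τ)) • ((5 : ℝ) • x (n - 1) - (8 : ℝ) • x (n - 2) + (3 : ℝ) • x (n - 3))

namespace BulkSurfaceFE

variable {d k : ℕ} (D : BulkSurfaceFE d k)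

/-- The auxiliary splitting scheme with step size `τ` and right-hand sides `fu`, `fp`, started
from consistent initial data: `û^{-1}, û^0` and `p^{-2}, p^{-1}, p^0` are the initial data, and for
every `n ≥ 1` the vectors `û^n = (û_1^n, û_2^n)`, `p^n`, `λ^n` satisfy the equations of the
scheme.  Values at smaller indices are irrelevant. -/
structure IsSolution (τ : ℝ) (fu : ℤ → Fin D.NI ⊕ Fin D.NB → ℝ) (fp : ℤ → Fin D.Np → ℝ)
    (u : ℤ → Fin D.NI ⊕ Fin D.NB → ℝ) (p : ℤ → Fin D.Np → ℝ) (lam : ℤ → Fin D.NB → ℝ) :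
    Prop where
  consistent_zero : D.Bu *ᵥ u 0 = D.Bp *ᵥ p 0
  consistent_neg_one : D.Bu *ᵥ u (-1) = D.Bp *ᵥ p (-1)
  eq_interior : ∀ n : ℤ, 1 ≤ n →
    D.Mu.toBlocks₁₁ *ᵥ bdf2 τ (fun j => u j ∘ Sum.inl) n + D.Ku.toBlocks₁₁ *ᵥ (u n ∘ Sum.inl) =
      fu n ∘ Sum.inl
        - D.Mu.toBlocks₁₂ *ᵥ (D.Mlam⁻¹ *ᵥ (D.Bp *ᵥ delayQuotient τ p n))
        - D.Ku.toBlocks₁₂ *ᵥ (D.Mlam⁻¹ *ᵥ (D.Bp *ᵥ ((2 : ℝ) • p (n - 1) - p (n - 2))))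
  eq_multiplier : ∀ n : ℤ, 1 ≤ n →
    D.Mu.toBlocks₂₁ *ᵥ bdf2 τ (fun j => u j ∘ Sum.inl) n + D.Ku.toBlocks₂₁ *ᵥ (u n ∘ Sum.inl)
        - D.Mlam *ᵥ lam n =
      fu n ∘ Sum.inr
        - D.Mu.toBlocks₂₂ *ᵥ (D.Mlam⁻¹ *ᵥ (D.Bp *ᵥ delayQuotient τ p n))
        - D.Ku.toBlocks₂₂ *ᵥ (D.Mlam⁻¹ *ᵥ (D.Bp *ᵥ ((2 : ℝ) • p (n - 1) - p (n - 2))))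
  eq_surface : ∀ n : ℤ, 1 ≤ n →
    D.Mp *ᵥ bdf2 τ p n + D.Kp *ᵥ p n + D.Bpᵀ *ᵥ lam n = fp n
  eq_trace : ∀ n : ℤ, 1 ≤ n → D.Mlam *ᵥ (u n ∘ Sum.inr) = D.Bp *ᵥ p n

/-- The bound in the stability estimate up to time step `m`: energy of the initial data and
contribution of the right-hand sides. -/
noncomputable def dataBound (cM τ : ℝ) (fu : ℤ → Fin D.NI ⊕ Fin D.NB → ℝ)
    (fp : ℤ → Fin D.Np → ℝ) (u : ℤ → Fin D.NI ⊕ Fin D.NB → ℝ) (p : ℤ → Fin D.Np → ℝ)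
    (m : ℤ) : ℝ :=
  sqNorm D.Ku (u 0) + sqNorm D.Kp (p 0)
    + τ / 2 * sqNorm D.Mu (τ⁻¹ • bdiff u 0)
    + τ / 2 * sqNorm D.Mp (τ⁻¹ • bdiff p 0)
    + 9 * cM * τ * D.h * sqNorm D.Mp (τ⁻¹ • bdiff (bdiff p) 0)
    + 2 * τ * ∑ j ∈ Finset.Icc 1 m, (sqNorm D.Mu⁻¹ (fu j) + sqNorm D.Mp⁻¹ (fp j))

/-- The energy part of the left-hand side of the stability estimate up to time step `m`, without
the second differences of `p`. -/
noncomputable def energy (τ : ℝ) (u : ℤ → Fin D.NI ⊕ Fin D.NB → ℝ) (p : ℤ → Fin D.Np → ℝ)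
    (m : ℤ) : ℝ :=
  sqNorm D.Ku (u m) + sqNorm D.Kp (p m)
    + τ * ∑ j ∈ Finset.Icc 1 m,
        (sqNorm D.Mu (τ⁻¹ • bdiff u j) + sqNorm D.Mp (τ⁻¹ • bdiff p j)
          + 1 / 2 * sqNorm D.Mu (τ⁻¹ • bdiff (bdiff u) j))
    + ∑ j ∈ Finset.Icc 1 m, sqNorm D.Kp (bdiff p j)

end BulkSurfaceFE

/-!
The auxiliary scheme replaces the trace `M_λ⁻¹ B_p pⁿ` in the bulk equations by an extrapolation
from earlier time levels.  By consistency of the traces it is therefore the monolithic BDF-2 scheme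
with two perturbations: the mass matrix applied to an extension of `3 / (2 τ) E³ pⁿ` and the
stiffness matrix applied to an extension of `E² pⁿ`, both with vanishing interior nodal values.
Testing with `E û` and `E p` gives the energy estimate of BDF-2, with numerical dissipation
proportional to `E² û` and `E² p`, which together with that of the first differences absorbs the
perturbations.

On each cell a function with vanishing interior nodal values is determined by its values on nearby
boundary faces.  By the equivalence of norms on polynomials of degree at most `k`, its squared mass
and stiffness norms are at most multiples of `h` and `h⁻¹` times the squared `L²(Γ)` norm of its
trace, which is why `h` small and `τ ≤ C h` suffice.
-/

/-! ### Polynomials of bounded degree -/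

theorem exists_norm_le_mul_norm_of_injective {𝕜 V W F Y : Type*} [NontriviallyNormedField 𝕜]
    [CompleteSpace 𝕜] [AddCommGroup V] [Module 𝕜 V] [NormedAddCommGroup W] [NormedSpace 𝕜 W]
    [FiniteDimensional 𝕜 W] [SeminormedAddCommGroup F] [NormedSpace 𝕜 F] [TopologicalSpace Y]
    {K : Set Y} (hK : IsCompact K) {L : V →ₗ[𝕜] W} (hL : Function.Injective L)
    (ev : Y → V →ₗ[𝕜] F) (hev : ∀ v, ContinuousOn (fun y => ev y v) K) :
    ∃ C > 0, ∀ v, ∀ y ∈ K, ‖ev y v‖ ≤ C * ‖L v‖ := by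
  have : CompleteSpace (LinearMap.range L) := FiniteDimensional.complete 𝕜 _
  let e := LinearEquiv.ofInjective L hL
  let g (y : K) : LinearMap.range L →L[𝕜] F := (ev y ∘ₗ e.symm.toLinearMap).toContinuousLinearMap
  obtain ⟨B, hB⟩ : ∃ B, ∀ y, ‖g y‖ ≤ B := by
    refine banach_steinhaus fun w => ?_
    obtain ⟨B, hB⟩ := hK.exists_bound_of_continuousOn (hev (e.symm w))
    exact ⟨B, fun y => hB y y.2⟩
  refine ⟨max B 1, by positivity, fun v y hy => ?_⟩
  calc ‖ev y v‖ = ‖g ⟨y, hy⟩ (e v)‖ := by simp [g]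
    _ ≤ max B 1 * ‖e v‖ := (g ⟨y, hy⟩).le_of_opNorm_le ((hB _).trans (le_max_left _ _)) _

theorem exists_abs_eval_derivative_le (k : ℕ) : ∃ C > 0, ∀ p : Polynomial ℝ, p.natDegree ≤ k →
    ∀ M : ℝ, (∀ t ∈ Set.Icc (0 : ℝ) 1, |p.eval t| ≤ M) →
      ∀ t ∈ Set.Icc (0 : ℝ) 1, |p.derivative.eval t| ≤ C * M := by
  let node (i : Fin (k + 1)) : ℝ := i / (k + 1)
  have node_injective : Function.Injective node := fun i j hij => Fin.ext <| by
    have hk : (k : ℝ) + 1 ≠ 0 := by positivity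
    exact_mod_cast (div_left_inj' hk).1 hij
  have node_mem (i) : node i ∈ Set.Icc (0 : ℝ) 1 :=
    ⟨by positivity, div_le_one_of_le₀ (by exact_mod_cast i.2.le) (by positivity)⟩
  let L : Polynomial.degreeLT ℝ (k + 1) →ₗ[ℝ] Fin (k + 1) → ℝ :=
    LinearMap.pi fun i => Polynomial.leval (node i) ∘ₗ Submodule.subtype _
  have L_injective : Function.Injective L := by
    refine (injective_iff_map_eq_zero L).2 fun p hp => Subtype.ext ?_
    refine Polynomial.eq_zero_of_degree_lt_of_eval_index_eq_zero (s := Finset.univ)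
      node_injective.injOn ?_ fun i _ => congrFun hp i
    simpa using Polynomial.mem_degreeLT.1 p.2
  obtain ⟨C, hC, hbound⟩ := exists_norm_le_mul_norm_of_injective (K := Set.Icc (0 : ℝ) 1)
    isCompact_Icc L_injective
    (fun t => Polynomial.leval t ∘ₗ Polynomial.derivative ∘ₗ Submodule.subtype _)
    fun p => (Polynomial.continuous p.1.derivative).continuousOn
  refine ⟨C, hC, fun p hp M hM t ht => ?_⟩
  have hmem : p ∈ Polynomial.degreeLT ℝ (k + 1) :=
    Polynomial.mem_degreeLT.2 <|
      (Polynomial.degree_le_of_natDegree_le hp).trans_lt (by exact_mod_cast k.lt_succ_self)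
  refine (hbound ⟨p, hmem⟩ t ht).trans (mul_le_mul_of_nonneg_left ?_ hC.le)
  exact (pi_norm_le_iff_of_nonempty _).2 fun i => hM _ (node_mem i)

theorem eq_zero_of_eval_lattice_eq_zero {σ R : Type*} [Fintype σ] [CommRing R] [IsDomain R]
    {x : ℕ → R} (hx : Function.Injective x) {Q : MvPolynomial σ R}
    (hQ : ∀ m : σ → ℕ, ∑ i, m i ≤ Q.totalDegree → Q.eval (fun i => x (m i)) = 0) : Q = 0 := by
  classical
  by_contra hne
  obtain ⟨t, ht, hdeg⟩ := Finset.exists_mem_eq_sup Q.support (MvPolynomial.support_nonempty.2 hne)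
    fun s => s.sum fun _ e => e
  obtain ⟨s, hs, heval⟩ := MvPolynomial.combinatorial_nullstellensatz_exists_eval_nonzero Q t
    (MvPolynomial.mem_support_iff.1 ht) hdeg (fun i => (Finset.range (t i + 1)).image x)
    fun i => by simp [Finset.card_image_of_injective _ hx]
  simp only [Finset.mem_image, Finset.mem_range, Nat.lt_succ_iff] at hs
  choose m hm hms using hs
  obtain rfl : (fun i => x (m i)) = s := funext hms
  refine heval (hQ m ?_)
  calc ∑ i, m i ≤ ∑ i, t i := Finset.sum_le_sum fun i _ => hm i
    _ = t.sum fun _ e => e := (Finsupp.sum_fintype t (fun _ e => e) fun _ => rfl).symm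
    _ = Q.totalDegree := hdeg.symm

theorem exists_abs_eval_le_of_lattice (n : ℕ) {k : ℕ} (hk : 1 ≤ k) :
    ∃ C > 0, ∀ Q : MvPolynomial (Fin n) ℝ, Q.totalDegree ≤ k → ∀ M : ℝ,
      (∀ m : Fin n → ℕ, ∑ i, m i ≤ k → |Q.eval fun i => (m i : ℝ) / k| ≤ M) →
      ∀ y ∈ Set.univ.pi fun _ => Set.Icc (0 : ℝ) 1, |Q.eval y| ≤ C * M := by
  let Lattice : Type := {m : Fin n → Fin (k + 1) // ∑ i, (m i : ℕ) ≤ k}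
  have : Nonempty Lattice := ⟨0, by simp⟩
  have toLattice (m : Fin n → ℕ) (hm : ∑ i, m i ≤ k) : ∃ z : Lattice, ∀ i, (z.1 i : ℕ) = m i :=
    ⟨⟨fun i => ⟨m i, Nat.lt_succ_of_le ((Finset.single_le_sum_of_canonicallyOrdered
      (Finset.mem_univ i)).trans hm)⟩, hm⟩, fun _ => rfl⟩
  let ev (y : Fin n → ℝ) : MvPolynomial.restrictTotalDegree (Fin n) ℝ k →ₗ[ℝ] ℝ :=
    (MvPolynomial.aeval y).toLinearMap ∘ₗ Submodule.subtype _
  have ev_apply (y Q) : ev y Q = Q.1.eval y := by simp [ev, MvPolynomial.aeval_eq_eval]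
  let L : MvPolynomial.restrictTotalDegree (Fin n) ℝ k →ₗ[ℝ] Lattice → ℝ :=
    LinearMap.pi fun m => ev fun i => (m.1 i : ℝ) / k
  have L_injective : Function.Injective L := by
    refine (injective_iff_map_eq_zero L).2 fun Q hQ => Subtype.ext ?_
    have hinj : Function.Injective fun j : ℕ => (j : ℝ) / k := fun i j hij => by
      exact_mod_cast (div_left_inj' (by positivity)).1 hij
    refine eq_zero_of_eval_lattice_eq_zero hinj fun m hm => ?_
    obtain ⟨z, hz⟩ := toLattice m
      (hm.trans ((MvPolynomial.mem_restrictTotalDegree _ _ _).1 Q.2))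
    simpa [L, ev_apply, hz] using congrFun hQ z
  obtain ⟨C, hC, hbound⟩ := exists_norm_le_mul_norm_of_injective
    (isCompact_univ_pi fun _ => isCompact_Icc) L_injective ev fun Q =>
      (Q.1.continuous_eval.congr fun y => (ev_apply y Q).symm).continuousOn
  refine ⟨C, hC, fun Q hQ M hM y hy => ?_⟩
  let Q' : MvPolynomial.restrictTotalDegree (Fin n) ℝ k :=
    ⟨Q, (MvPolynomial.mem_restrictTotalDegree _ _ _).2 hQ⟩
  have hy' := hbound Q' y hy
  rw [ev_apply] at hy'
  refine hy'.trans (mul_le_mul_of_nonneg_left ?_ hC.le)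
  refine (pi_norm_le_iff_of_nonempty _).2 fun m => ?_
  simpa [L, ev_apply] using hM (fun i => m.1 i) m.2

theorem totalDegree_aeval_le {R σ τ : Type*} [CommSemiring R] (F : MvPolynomial σ R)
    {f : σ → MvPolynomial τ R} (hf : ∀ i, (f i).totalDegree ≤ 1) :
    (MvPolynomial.aeval f F).totalDegree ≤ F.totalDegree := by
  rw [MvPolynomial.aeval_def, MvPolynomial.eval₂]
  refine MvPolynomial.totalDegree_finsetSum_le fun m hm => ?_
  calc (MvPolynomial.C (F.coeff m) * m.prod fun i e => f i ^ e).totalDegree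
    _ ≤ (m.prod fun i e => f i ^ e).totalDegree := by
      simpa using MvPolynomial.totalDegree_mul (MvPolynomial.C (F.coeff m)) _
    _ ≤ ∑ i ∈ m.support, (f i ^ m i).totalDegree := MvPolynomial.totalDegree_finsetProd _ _
    _ ≤ ∑ i ∈ m.support, m i := Finset.sum_le_sum fun i _ =>
      (MvPolynomial.totalDegree_pow _ _).trans (mul_le_of_le_one_right' (hf i))
    _ ≤ F.totalDegree := MvPolynomial.le_totalDegree hm

/-- A constant `C` in the inequality `max |p'| ≤ C max |p|` on `[0, 1]` for real polynomials `p` of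
degree at most `k`. By the theorem of the Markov brothers the best constant is `2 k²`, but only
its existence matters here. -/
noncomputable def markovConst (k : ℕ) : ℝ := (exists_abs_eval_derivative_le k).choose

theorem markovConst_pos (k : ℕ) : 0 < markovConst k :=
  (exists_abs_eval_derivative_le k).choose_spec.1

theorem abs_eval_derivative_le {k : ℕ} {p : Polynomial ℝ} (hp : p.natDegree ≤ k) {M : ℝ}
    (hM : ∀ t ∈ Set.Icc (0 : ℝ) 1, |p.eval t| ≤ M) {t : ℝ} (ht : t ∈ Set.Icc (0 : ℝ) 1) :
    |p.derivative.eval t| ≤ markovConst k * M :=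
  (exists_abs_eval_derivative_le k).choose_spec.2 p hp M hM t ht

/-! ### Inverse estimates for polynomials on convex sets -/

namespace IsPolyOn

variable {d k : ℕ} {v : Euc d → ℝ} {S : Set (Euc d)}

theorem sum_mul {ι : Type*} (s : Finset ι) (c : ι → ℝ) {f : ι → Euc d → ℝ}
    (hf : ∀ i, IsPolyOn k (f i) S) : IsPolyOn k (fun x => ∑ i ∈ s, c i * f i x) S := by
  choose P hP hf using hf
  refine ⟨∑ i ∈ s, MvPolynomial.C (c i) * P i,
    MvPolynomial.totalDegree_finsetSum_le fun i _ => ?_, fun x hx => ?_⟩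
  · exact (MvPolynomial.totalDegree_mul _ _).trans (by simpa using hP i)
  · simp only [map_sum, map_mul, MvPolynomial.eval_C]
    exact Finset.sum_congr rfl fun i _ => by rw [hf i x hx]

theorem exists_contDiff_eqOn (hv : IsPolyOn k v S) : ∃ w, ContDiff ℝ ⊤ w ∧ Set.EqOn v w S := by
  obtain ⟨P, -, hv⟩ := hv
  exact ⟨_, (AnalyticOnNhd.eval_linearMap'
    (fun i => (EuclideanSpace.proj i : Euc d →L[ℝ] ℝ).toLinearMap) P).contDiff, hv⟩

theorem continuousOn (hv : IsPolyOn k v S) : ContinuousOn v S := by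
  obtain ⟨w, hw, hvw⟩ := hv.exists_contDiff_eqOn
  exact hw.continuous.continuousOn.congr hvw

theorem differentiableAt (hv : IsPolyOn k v S) {x : Euc d} (hx : x ∈ interior S) :
    DifferentiableAt ℝ v x := by
  obtain ⟨w, hw, hvw⟩ := hv.exists_contDiff_eqOn
  exact (hw.differentiable (by simp) x).congr_of_eventuallyEq
    (hvw.eventuallyEq_of_mem (mem_interior_iff_mem_nhds.1 hx))

theorem exists_mvPolynomial_eval_eq {ι : Type*} [Finite ι] (hv : IsPolyOn k v S) (x : Euc d)
    (T : (ι → ℝ) →ₗ[ℝ] Euc d) : ∃ Q : MvPolynomial ι ℝ, Q.totalDegree ≤ k ∧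
      ∀ y, x + T y ∈ S → Q.eval y = v (x + T y) := by
  classical
  cases nonempty_fintype ι
  obtain ⟨P, hP, hv⟩ := hv
  have hT (y) : T y = ∑ j, y j • T (Pi.single j 1) := by
    simpa using congrArg T ((Pi.basisFun ℝ ι).sum_repr y).symm
  let f (i : Fin d) : MvPolynomial ι ℝ :=
    MvPolynomial.C (x i) + ∑ j, MvPolynomial.X j * MvPolynomial.C (T (Pi.single j 1) i)
  have hf (i) : (f i).totalDegree ≤ 1 := by
    refine (MvPolynomial.totalDegree_add _ _).trans
      (max_le (by simp) (MvPolynomial.totalDegree_finsetSum_le fun j _ => ?_))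
    exact (MvPolynomial.totalDegree_mul _ _).trans (by simp)
  refine ⟨MvPolynomial.aeval f P, (totalDegree_aeval_le P hf).trans hP, fun y hy => ?_⟩
  rw [hv _ hy, ← MvPolynomial.aeval_eq_eval, ← MvPolynomial.aeval_eq_eval,
    MvPolynomial.comp_aeval_apply]
  congr 2
  ext i
  simp [f, hT y]

theorem exists_polynomial_eval_eq (hv : IsPolyOn k v S) (x y : Euc d) :
    ∃ p : Polynomial ℝ, p.natDegree ≤ k ∧
      ∀ t : ℝ, AffineMap.lineMap x y t ∈ S → p.eval t = v (AffineMap.lineMap x y t) := by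
  obtain ⟨P, hP, hv⟩ := hv
  let f (i : Fin d) : Polynomial ℝ :=
    Polynomial.C (x i) + Polynomial.X * Polynomial.C (y i - x i)
  have hf (i) : (f i).natDegree ≤ 1 := by
    refine (Polynomial.natDegree_add_le _ _).trans (max_le (by simp) ?_)
    exact (Polynomial.natDegree_mul_C_le _ _).trans Polynomial.natDegree_X_le
  refine ⟨MvPolynomial.aeval f P,
    (MvPolynomial.aeval_natDegree_le P hP f hf).trans (mul_one k).le, fun t ht => ?_⟩
  rw [hv _ ht, ← Polynomial.coe_aeval_eq_eval, ← MvPolynomial.aeval_eq_eval,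
    MvPolynomial.comp_aeval_apply]
  congr 2
  ext i
  simp [f, AffineMap.lineMap_apply, add_comm]

theorem abs_lineMap_sub_le (hv : IsPolyOn k v S) (hS : Convex ℝ S) {M : ℝ}
    (hM : ∀ x ∈ S, |v x| ≤ M) {x y : Euc d} (hx : x ∈ S) (hy : y ∈ S) {t : ℝ}
    (ht : t ∈ Set.Icc (0 : ℝ) 1) :
    |v (AffineMap.lineMap x y t) - v x| ≤ markovConst k * M * t := by
  obtain ⟨p, hp, hpv⟩ := hv.exists_polynomial_eval_eq x y
  replace hpv (t) (ht : t ∈ Set.Icc (0 : ℝ) 1) : p.eval t = v (AffineMap.lineMap x y t) :=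
    hpv t (hS.lineMap_mem hx hy ht)
  have hderiv (s) (hs : s ∈ Set.Icc (0 : ℝ) 1) :
      ‖deriv (fun t => p.eval t) s‖ ≤ markovConst k * M := by
    rw [Polynomial.deriv]
    exact abs_eval_derivative_le hp (fun t ht => hpv t ht ▸ hM _ (hS.lineMap_mem hx hy ht)) hs
  have hmvt := (convex_Icc (0 : ℝ) 1).norm_image_sub_le_of_norm_deriv_le
    (fun _ _ => p.differentiableAt) hderiv ⟨le_rfl, zero_le_one⟩ ht
  simpa [hpv t ht, hpv 0 ⟨le_rfl, zero_le_one⟩, abs_of_nonneg ht.1] using hmvt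

theorem abs_fderiv_sub_le (hv : IsPolyOn k v S) (hS : Convex ℝ S) {M : ℝ}
    (hM : ∀ x ∈ S, |v x| ≤ M) {x y : Euc d} (hx : x ∈ interior S) (hy : y ∈ S) :
    |fderiv ℝ v x (y - x)| ≤ markovConst k * M := by
  obtain ⟨p, hp, hpv⟩ := hv.exists_polynomial_eval_eq x y
  have hmem (t) (ht : t ∈ Set.Icc (0 : ℝ) 1) : AffineMap.lineMap x y t ∈ S :=
    hS.lineMap_mem (interior_subset hx) hy ht
  have hline : HasDerivAt (fun t : ℝ => v (AffineMap.lineMap x y t)) (fderiv ℝ v x (y - x)) 0 := by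
    refine HasFDerivAt.comp_hasDerivAt 0 ?_ AffineMap.hasDerivAt_lineMap
    simpa using (hv.differentiableAt hx).hasFDerivAt
  have hnear : ∀ᶠ t : ℝ in nhds 0, AffineMap.lineMap x y t ∈ S :=
    AffineMap.lineMap_continuous.continuousAt.eventually_mem
      (by simpa using mem_interior_iff_mem_nhds.1 hx)
  rw [← (hline.congr_of_eventuallyEq (hnear.mono hpv)).deriv, Polynomial.deriv]
  exact abs_eval_derivative_le hp (fun t ht => hpv t (hmem t ht) ▸ hM _ (hmem t ht))
    ⟨le_rfl, zero_le_one⟩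

theorem norm_gradient_le (hv : IsPolyOn k v S) (hS : Convex ℝ S) {M : ℝ}
    (hM : ∀ x ∈ S, |v x| ≤ M) {c : Euc d} {r : ℝ} (hr : 0 < r) (hc : Metric.closedBall c r ⊆ S)
    {x : Euc d} (hx : x ∈ interior S) : ‖gradient v x‖ ≤ markovConst k * M / r := by
  have hM₀ : 0 ≤ markovConst k * M :=
    mul_nonneg (markovConst_pos k).le ((abs_nonneg _).trans (hM x (interior_subset hx)))
  rw [gradient, LinearIsometryEquiv.norm_map]
  refine ContinuousLinearMap.opNorm_le_of_unit_norm (by positivity) fun e he => ?_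
  have hpole (t : ℝ) (ht : |t| = r) : |fderiv ℝ v x (c + t • e - x)| ≤ markovConst k * M :=
    hv.abs_fderiv_sub_le hS hM hx (hc (by simp [norm_smul, he, ht]))
  have hdiam : fderiv ℝ v x (c + r • e - x) - fderiv ℝ v x (c + (-r) • e - x) =
      2 * r * fderiv ℝ v x e := by
    rw [← map_sub, show c + r • e - x - (c + (-r) • e - x) = (2 * r) • e by module, map_smul,
      smul_eq_mul]
  have hsum : 2 * r * |fderiv ℝ v x e| ≤ markovConst k * M + markovConst k * M := by
    rw [← abs_of_pos (by positivity : 0 < 2 * r), ← abs_mul, ← hdiam]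
    exact (abs_sub _ _).trans
      (add_le_add (hpole r (abs_of_pos hr)) (hpole (-r) (by rw [abs_neg, abs_of_pos hr])))
  rw [le_div_iff₀ hr, Real.norm_eq_abs]
  linarith

theorem exists_norm_gradient_le (hv : IsPolyOn k v S) (hS : IsCompact S) (hconv : Convex ℝ S) :
    ∃ B, ∀ x ∈ interior S, ‖gradient v x‖ ≤ B := by
  obtain ⟨M, hM⟩ := hS.exists_bound_of_continuousOn hv.continuousOn
  rcases (interior S).eq_empty_or_nonempty with hempty | ⟨c, hc⟩
  · exact ⟨0, by simp [hempty]⟩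
  · obtain ⟨r, hr, hball⟩ := Metric.nhds_basis_closedBall.mem_iff.1 (mem_interior_iff_mem_nhds.1 hc)
    exact ⟨_, fun x hx => hv.norm_gradient_le hconv hM hr hball hx⟩

end IsPolyOn

theorem exists_abs_le_of_barycentric_lattice (n : ℕ) {k : ℕ} (hk : 1 ≤ k) : ∃ C > 0, ∀ (d : ℕ)
    (a : Fin (n + 1) → Euc d) (v : Euc d → ℝ), IsPolyOn k v (convexHull ℝ (Set.range a)) →
      ∀ M : ℝ, (∀ m : Fin (n + 1) → ℕ, ∑ j, m j = k → |v (∑ j, ((m j : ℝ) / k) • a j)| ≤ M) →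
      ∀ w ∈ stdSimplex ℝ (Fin (n + 1)), |v (∑ j, w j • a j)| ≤ C * M := by
  obtain ⟨C, hC, hbound⟩ := exists_abs_eval_le_of_lattice n hk
  refine ⟨C, hC, fun d a v hv M hM w hw => ?_⟩
  let T : (Fin n → ℝ) →ₗ[ℝ] Euc d := Fintype.linearCombination ℝ fun j => a j.succ - a 0
  obtain ⟨Q, hQ, hQv⟩ := hv.exists_mvPolynomial_eval_eq (a 0) T
  have barycentric {w : Fin (n + 1) → ℝ} (hw : ∑ j, w j = 1) :
      ∑ j, w j • a j = a 0 + T (fun j => w j.succ) := by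
    rw [Fin.sum_univ_succ] at hw ⊢
    simp only [T, Fintype.linearCombination_apply, smul_sub, Finset.sum_sub_distrib,
      ← Finset.sum_smul, eq_sub_of_add_eq hw]
    module
  have eval_eq {w : Fin (n + 1) → ℝ} (hw : w ∈ stdSimplex ℝ (Fin (n + 1))) :
      Q.eval (fun j => w j.succ) = v (∑ j, w j • a j) := by
    rw [barycentric hw.2]
    refine hQv _ (barycentric hw.2 ▸ ?_)
    exact (convex_convexHull ℝ _).sum_mem (fun j _ => hw.1 j) hw.2
      fun j _ => subset_convexHull ℝ _ (Set.mem_range_self j)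
  rw [← eval_eq hw]
  refine hbound Q hQ M (fun m hm => ?_) _ fun j _ => ⟨hw.1 _, ?_⟩
  · let m' : Fin (n + 1) → ℕ := Fin.cons (k - ∑ i, m i) m
    have hm' : ∑ j, m' j = k := by simp [m', Fin.sum_univ_succ, hm]
    have hmk : ∑ j, (m' j : ℝ) / k = 1 := by
      rw [← Finset.sum_div, div_eq_one_iff_eq (by positivity)]
      exact_mod_cast hm'
    have hQm := hM m' hm'
    rwa [← eval_eq ⟨fun j => by positivity, hmk⟩] at hQm
  · exact (Finset.single_le_sum (fun i _ => hw.1 i) (Finset.mem_univ _)).trans hw.2.le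

theorem exists_abs_le_of_nodes (n : ℕ) {k : ℕ} (hk : 1 ≤ k) : ∃ C > 0, ∀ (d : ℕ)
    (s : Finset (Euc d)), s.card = n + 1 → ∀ v : Euc d → ℝ, IsPolyOn k v (simplexHull s) →
      ∀ M : ℝ, (∀ m : Euc d → ℕ, ∑ a ∈ s, m a = k → |v (∑ a ∈ s, ((m a : ℝ) / k) • a)| ≤ M) →
      ∀ x ∈ simplexHull s, |v x| ≤ C * M := by
  classical
  obtain ⟨C, hC, hbound⟩ := exists_abs_le_of_barycentric_lattice n hk
  refine ⟨C, hC, fun d s hs v hv M hM x hx => ?_⟩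
  let e : s ≃ Fin (n + 1) := s.equivFinOfCardEq hs
  let a (j : Fin (n + 1)) : Euc d := e.symm j
  have range_a : Set.range a = s := by
    rw [show a = Subtype.val ∘ e.symm from rfl, e.symm.surjective.range_comp, Subtype.range_coe]
  have sum_eq {E : Type} [AddCommMonoid E] (f : Euc d → E) : ∑ b ∈ s, f b = ∑ j, f (a j) := by
    rw [← Finset.sum_coe_sort s f]
    exact (Equiv.sum_comp e.symm fun b : s => f b).symm
  obtain ⟨w, hw₀, hw₁, rfl⟩ := Finset.mem_convexHull'.1 hx
  rw [sum_eq] at hw₁ ⊢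
  rw [simplexHull, ← range_a] at hv
  refine hbound d a v hv M (fun m hm => ?_) (fun j => w (a j)) ⟨fun j => hw₀ _ (e.symm j).2, hw₁⟩
  let m' (b : Euc d) : ℕ := if hb : b ∈ s then m (e ⟨b, hb⟩) else 0
  have hm' (j) : m' (a j) = m j := by simp [m', a]
  simpa only [sum_eq, hm', hm, forall_const] using hM m'

theorem integrableOn_of_continuousOn_isCompact {X E : Type*} [TopologicalSpace X]
    [MeasurableSpace X] [OpensMeasurableSpace X] [T2Space X] [NormedAddCommGroup E]
    [SecondCountableTopology E] {μ : Measure X} {f : X → E} {S : Set X} (hf : ContinuousOn f S)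
    (hS : IsCompact S) (hμ : μ S ≠ ⊤) : IntegrableOn f S μ := by
  obtain ⟨C, hC⟩ := hS.exists_bound_of_continuousOn hf
  exact .of_bound hμ.lt_top (hf.aestronglyMeasurable hS.measurableSet) C
    ((ae_restrict_mem hS.measurableSet).mono hC)

/-- The constant of the `L²`--`L^∞` inverse inequality on `n`-dimensional convex sets. -/
noncomputable def inverseConst (n k : ℕ) : ℝ := 4 * max 1 (2 * markovConst k) ^ n

theorem inverseConst_pos (n k : ℕ) : 0 < inverseConst n k := by
  unfold inverseConst
  positivity

namespace IsPolyOn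

variable {d k n : ℕ} {v : Euc d → ℝ} {S : Set (Euc d)}

theorem half_abs_le_abs_lineMap (hv : IsPolyOn k v S) (hS : Convex ℝ S) {x y : Euc d} (hx : x ∈ S)
    (hmax : ∀ z ∈ S, |v z| ≤ |v x|) (hy : y ∈ S) {t : ℝ} (ht : t ∈ Set.Icc (0 : ℝ) 1)
    (hkt : 2 * markovConst k * t ≤ 1) : |v x| / 2 ≤ |v (AffineMap.lineMap x y t)| := by
  have hincr := hv.abs_lineMap_sub_le hS hmax hx hy ht
  have hdrop := abs_sub_abs_le_abs_sub (v x) (v (AffineMap.lineMap x y t))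
  rw [abs_sub_comm] at hdrop
  nlinarith [abs_nonneg (v x)]

theorem integrableOn_sq {μ : Measure (Euc d)} (hv : IsPolyOn k v S) (hS : IsCompact S)
    (hμ : μ S ≠ ⊤) : IntegrableOn (fun y => v y ^ 2) S μ :=
  integrableOn_of_continuousOn_isCompact (hv.continuousOn.pow 2) hS hμ

/-- Near a maximum point of `|v|` the polynomial stays above half of its maximum, on a scaled copy
of the convex set whose relative size depends only on the degree. -/
theorem sq_mul_measureReal_le (hv : IsPolyOn k v S) (hS : IsCompact S) (hconv : Convex ℝ S)
    (hfin : μHE[n] S ≠ ⊤) {x : Euc d} (hx : x ∈ S) :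
    v x ^ 2 * μHE[n].real S ≤ inverseConst n k * ∫ y in S, v y ^ 2 ∂μHE[n] := by
  obtain ⟨x₀, hx₀, hmax⟩ := hS.exists_isMaxOn ⟨x, hx⟩ hv.continuousOn.abs
  set R := max 1 (2 * markovConst k)
  have hR : 0 < R := by positivity
  set S' := AffineMap.homothety x₀ R⁻¹ '' S
  have hR_mem : R⁻¹ ∈ Set.Icc (0 : ℝ) 1 := ⟨by positivity, inv_le_one_of_one_le₀ (le_max_left _ _)⟩
  have hS'S : S' ⊆ S := by
    rintro _ ⟨z, hz, rfl⟩
    exact hconv.lineMap_mem hx₀ hz hR_mem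
  have hlower : ∀ y ∈ S', (|v x₀| / 2) ^ 2 ≤ v y ^ 2 := by
    rintro _ ⟨z, hz, rfl⟩
    rw [← sq_abs (v _)]
    gcongr
    refine hv.half_abs_le_abs_lineMap hconv hx₀ hmax hz (t := R⁻¹) hR_mem ?_
    rw [mul_inv_le_iff₀ hR, one_mul]
    exact le_max_right _ _
  have hS' : MeasurableSet S' := (hS.image (AffineMap.homothety_continuous x₀ _)).measurableSet
  have hvol : μHE[n].real S' * R ^ n = μHE[n].real S := by
    rw [measureReal_def, euclideanHausdorffMeasure_homothety_image n x₀ (inv_ne_zero hR.ne')]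
    simp [abs_of_pos hR, measureReal_def, hR.ne', mul_right_comm]
  calc v x ^ 2 * μHE[n].real S ≤ |v x₀| ^ 2 * μHE[n].real S := by
        rw [← sq_abs (v x)]
        gcongr ?_ ^ 2 * _
        exact hmax hx
    _ = inverseConst n k * ∫ _ in S', (|v x₀| / 2) ^ 2 ∂μHE[n] := by
        rw [setIntegral_const, smul_eq_mul, ← hvol, inverseConst]
        ring
    _ ≤ inverseConst n k * ∫ y in S', v y ^ 2 ∂μHE[n] := by
        gcongr ?_ * ?_
        · exact (inverseConst_pos n k).le
        · exact setIntegral_mono_on (integrableOn_const (measure_ne_top_of_subset hS'S hfin))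
            ((hv.integrableOn_sq hS hfin).mono_set hS'S) hS' hlower
    _ ≤ inverseConst n k * ∫ y in S, v y ^ 2 ∂μHE[n] := by
        gcongr ?_ * ?_
        · exact (inverseConst_pos n k).le
        · exact setIntegral_mono_set (hv.integrableOn_sq hS hfin)
            (Filter.Eventually.of_forall fun y => sq_nonneg _) hS'S.eventuallyLE

theorem eqOn_zero_of_setIntegral_sq_eq_zero (hv : IsPolyOn k v S) (hS : IsCompact S)
    (hconv : Convex ℝ S) (hpos : μHE[n] S ≠ 0) (hfin : μHE[n] S ≠ ⊤)
    (hint : ∫ y in S, v y ^ 2 ∂μHE[n] = 0) : Set.EqOn v 0 S := fun x hx => by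
  have hle := hv.sq_mul_measureReal_le hS hconv hfin hx
  rw [hint, mul_zero] at hle
  have hzero : v x ^ 2 * μHE[n].real S = 0 := le_antisymm hle (by positivity)
  simpa [measureReal_eq_zero_iff hfin, hpos] using hzero

end IsPolyOn

/-! ### Simplices: Hausdorff measure and packing -/

section HausdorffMeasure

variable {E : Type*} [NormedAddCommGroup E] [NormedSpace ℝ E] [FiniteDimensional ℝ E]
  [MeasurableSpace E] [BorelSpace E] {S : Set E}

theorem exists_euclideanHausdorffMeasure_eq_of_convex (hS : Convex ℝ S) (hne : S.Nonempty) :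
    ∃ T : Set (vectorSpan ℝ S), (interior T).Nonempty ∧
      (Bornology.IsBounded S → Bornology.IsBounded T) ∧ ∀ n, μHE[n] T = μHE[n] S := by
  obtain ⟨p, hp⟩ := id hne
  have : Nonempty (affineSpan ℝ S) := ⟨p, subset_affineSpan ℝ S hp⟩
  let φ := AffineIsometryEquiv.constVSub ℝ (⟨p, subset_affineSpan ℝ S hp⟩ : affineSpan ℝ S)
  have coe_image : (↑) '' ((↑) ⁻¹' S : Set (affineSpan ℝ S)) = S :=
    Set.image_preimage_eq_of_subset ((subset_affineSpan ℝ S).trans Subtype.range_coe.superset)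
  rw [← direction_affineSpan]
  refine ⟨φ '' ((↑) ⁻¹' S), ?_, fun hbdd => ?_, fun n => ?_⟩
  · rw [← φ.coe_toHomeomorph, ← φ.toHomeomorph.image_interior, Set.image_nonempty]
    simpa [intrinsicInterior] using (intrinsicInterior_nonempty hS).2 hne
  · exact φ.lipschitz.isBounded_image (isometry_subtype_coe.antilipschitz.isBounded_preimage hbdd)
  · rw [φ.isometry.euclideanHausdorffMeasure_image,
      ← isometry_subtype_coe.euclideanHausdorffMeasure_image]
    exact congrArg _ coe_image

theorem euclideanHausdorffMeasure_pos_of_convex (hS : Convex ℝ S) (hne : S.Nonempty) :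
    0 < μHE[Module.finrank ℝ (vectorSpan ℝ S)] S := by
  obtain ⟨T, hT, -, hTS⟩ := exists_euclideanHausdorffMeasure_eq_of_convex hS hne
  rw [← hTS]
  exact Measure.measure_pos_of_nonempty_interior _ hT

theorem euclideanHausdorffMeasure_lt_top_of_convex (hS : Convex ℝ S) (hne : S.Nonempty)
    (hbdd : Bornology.IsBounded S) : μHE[Module.finrank ℝ (vectorSpan ℝ S)] S < ⊤ := by
  obtain ⟨T, -, hT, hTS⟩ := exists_euclideanHausdorffMeasure_eq_of_convex hS hne
  rw [← hTS]
  exact (hT hbdd).measure_lt_top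

end HausdorffMeasure

section Simplices

variable {d n : ℕ} {s t : Finset (Euc d)}

theorem isCompact_simplexHull (s : Finset (Euc d)) : IsCompact (simplexHull s) :=
  s.finite_toSet.isCompact_convexHull ℝ

theorem convex_simplexHull (s : Finset (Euc d)) : Convex ℝ (simplexHull s) :=
  convex_convexHull ℝ _

theorem finrank_vectorSpan_simplexHull (hs : AffineIndependent ℝ ((↑) : s → Euc d))
    (hcard : s.card = n + 1) : Module.finrank ℝ (vectorSpan ℝ (simplexHull s)) = n := by
  have hrank := hs.finrank_vectorSpan (n := n) (by simpa using hcard)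
  rwa [Subtype.range_coe_subtype, ← direction_affineSpan, ← affineSpan_convexHull,
    direction_affineSpan] at hrank

theorem euclideanHausdorffMeasure_simplexHull_pos (hs : AffineIndependent ℝ ((↑) : s → Euc d))
    (hcard : s.card = n + 1) : 0 < μHE[n] (simplexHull s) := by
  have hne : (simplexHull s).Nonempty := by simp [simplexHull, ← Finset.card_pos, hcard]
  simpa only [finrank_vectorSpan_simplexHull hs hcard]
    using euclideanHausdorffMeasure_pos_of_convex (convex_simplexHull s) hne

theorem euclideanHausdorffMeasure_simplexHull_lt_top (hs : AffineIndependent ℝ ((↑) : s → Euc d))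
    (hcard : s.card = n + 1) : μHE[n] (simplexHull s) < ⊤ := by
  have hne : (simplexHull s).Nonempty := by simp [simplexHull, ← Finset.card_pos, hcard]
  simpa only [finrank_vectorSpan_simplexHull hs hcard] using
    euclideanHausdorffMeasure_lt_top_of_convex (convex_simplexHull s) hne
      (isCompact_simplexHull s).isBounded

theorem volume_simplexHull_inter_eq_zero {K : Geometry.SimplicialComplex ℝ (Euc d)}
    (hs : s ∈ K.faces) (ht : t ∈ K.faces) (hcard : s.card = t.card) (hne : s ≠ t) :
    volume (simplexHull s ∩ simplexHull t) = 0 := by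
  obtain ⟨a, has, hat⟩ : ∃ a ∈ s, a ∉ t := by
    by_contra! hsub
    exact hne (Finset.eq_of_subset_of_card_le hsub hcard.ge)
  have hsub : simplexHull s ∩ simplexHull t ⊆ affineSpan ℝ ((s : Set (Euc d)) ∩ t) :=
    (K.inter_subset_convexHull hs ht).trans (convexHull_subset_affineSpan _)
  have ha : a ∉ affineSpan ℝ ((s : Set (Euc d)) ∩ t) := by
    have himage : ((↑) : s → Euc d) '' {b | (b : Euc d) ∈ t} = (s : Set (Euc d)) ∩ t := by
      ext; simp [and_comm]
    rw [← himage, (K.indep hs).mem_affineSpan_iff ⟨a, has⟩]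
    exact hat
  exact measure_mono_null hsub (Measure.addHaar_affineSubspace _ _ fun htop =>
    ha (htop ▸ AffineSubspace.mem_top ℝ _ a))

end Simplices

theorem volume_closedBall_le_measure_orthogonalProjectionOnto {E : Type*} [NormedAddCommGroup E]
    [InnerProductSpace ℝ E] [MeasurableSpace E] [BorelSpace E] {n : ℕ} {W : Submodule ℝ E}
    [W.HasOrthogonalProjection] (b : OrthonormalBasis (Fin n) ℝ W) {S : Set E} {c : E} {r : ℝ}
    (hball : Metric.closedBall c r ⊆ S) :
    volume (Metric.closedBall (0 : Euc n) r) ≤ μHE[n] (W.orthogonalProjectionOnto '' S) := by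
  have hiso : Isometry fun z : Euc n => W.orthogonalProjectionOnto c + b.repr.symm z :=
    (IsometryEquiv.addLeft _).isometry.comp b.repr.symm.isometry
  rw [← EuclideanSpace.euclideanHausdorffMeasure_eq_volume, ← hiso.euclideanHausdorffMeasure_image]
  refine measure_mono ?_
  rintro _ ⟨z, hz, rfl⟩
  refine ⟨c + b.repr.symm z, hball ?_, ?_⟩
  · simpa [mem_closedBall_iff_norm, ← Submodule.coe_norm] using hz
  · rw [map_add, Submodule.orthogonalProjectionOnto_mem_subspace_eq_self]

/-- Projecting along an edge at the vertex `a` maps the whole simplex onto the image of the facet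
opposite to `a`. -/
theorem volume_closedBall_le_measure_facet {n : ℕ} {F : Finset (Euc (n + 1))}
    {a c : Euc (n + 1)} {r : ℝ} (hF : F.Nonempty) (ha : a ∉ F)
    (hball : Metric.closedBall c r ⊆ convexHull ℝ (insert a (F : Set (Euc (n + 1))))) :
    volume (Metric.closedBall (0 : Euc n) r) ≤ μHE[n] (simplexHull F) := by
  obtain ⟨b, hb⟩ := hF
  have hab : a - b ≠ 0 := fun h => ha (by rwa [sub_eq_zero.1 h])
  have : Fact (Module.finrank ℝ (Euc (n + 1)) = n + 1) := ⟨by simp⟩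
  let W : Submodule ℝ (Euc (n + 1)) := (ℝ ∙ (a - b))ᗮ
  have proj_eq : W.orthogonalProjectionOnto a = W.orthogonalProjectionOnto b := by
    rw [← sub_eq_zero, ← map_sub]
    exact Submodule.orthogonalProjectionOnto_orthogonal_apply_eq_zero
      (Submodule.mem_span_singleton_self _)
  have image_eq : W.orthogonalProjectionOnto '' convexHull ℝ (insert a (F : Set (Euc (n + 1)))) =
      W.orthogonalProjectionOnto '' simplexHull F := by
    simp_rw [simplexHull, ← ContinuousLinearMap.coe_coe W.orthogonalProjectionOnto,
      LinearMap.image_convexHull, Set.image_insert_eq, ContinuousLinearMap.coe_coe, proj_eq]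
    rw [Set.insert_eq_of_mem (Set.mem_image_of_mem _ (Finset.mem_coe.2 hb))]
  calc volume (Metric.closedBall (0 : Euc n) r)
      ≤ μHE[n] (W.orthogonalProjectionOnto '' simplexHull F) := image_eq ▸
        volume_closedBall_le_measure_orthogonalProjectionOnto
          (OrthonormalBasis.fromOrthogonalSpanSingleton n hab) hball
    _ ≤ μHE[n] (simplexHull F) := by
      simp only [Measure.euclideanHausdorffMeasure_def, Measure.smul_apply]
      gcongr
      exact hausdorffMeasure_orthogonalProjectionOnto_le W _ _ (Nat.cast_nonneg n)

theorem card_le_of_closedBall_subset {E ι : Type*} [NormedAddCommGroup E] [NormedSpace ℝ E]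
    [FiniteDimensional ℝ E] [MeasurableSpace E] [BorelSpace E] (μ : Measure E)
    [μ.IsAddHaarMeasure] (I : Finset ι) (T : ι → Set E) (hT : ∀ i ∈ I, MeasurableSet (T i))
    (hdisj : (I : Set ι).Pairwise (Function.onFun (AEDisjoint μ) T)) {r R : ℝ}
    (hr : 0 < r) (hR : 0 ≤ R) (hball : ∀ i ∈ I, ∃ c, Metric.closedBall c r ⊆ T i)
    {y : E} (hsub : ∀ i ∈ I, T i ⊆ Metric.closedBall y R) :
    (I.card : ℝ) ≤ (R / r) ^ Module.finrank ℝ E := by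
  set ω := μ.real (Metric.ball 0 1) with hω
  have volume_closedBall (x : E) {ρ : ℝ} (hρ : 0 ≤ ρ) :
      μ.real (Metric.closedBall x ρ) = ρ ^ Module.finrank ℝ E * ω := by
    rw [measureReal_def, Measure.addHaar_closedBall _ _ hρ, hω, measureReal_def]
    simp [hρ]
  have hω_pos : 0 < ω := ENNReal.toReal_pos (Metric.measure_ball_pos _ _ one_pos).ne'
    measure_ball_lt_top.ne
  have ne_top (i) (hi : i ∈ I) : μ (T i) ≠ ⊤ :=
    measure_ne_top_of_subset (hsub i hi) measure_closedBall_lt_top.ne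
  have hsum : I.card * (r ^ Module.finrank ℝ E * ω) ≤ R ^ Module.finrank ℝ E * ω := by
    calc (I.card : ℝ) * (r ^ Module.finrank ℝ E * ω)
        = ∑ _ ∈ I, r ^ Module.finrank ℝ E * ω := by rw [Finset.sum_const, nsmul_eq_mul]
      _ ≤ ∑ i ∈ I, μ.real (T i) := Finset.sum_le_sum fun i hi => by
          obtain ⟨c, hc⟩ := hball i hi
          rw [← volume_closedBall c hr.le]
          exact measureReal_mono hc (ne_top i hi)
      _ = μ.real (⋃ i ∈ I, T i) := (measureReal_biUnion_finset₀ hdisj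
          (fun i hi => (hT i hi).nullMeasurableSet) ne_top).symm
      _ ≤ μ.real (Metric.closedBall y R) :=
          measureReal_mono (Set.iUnion₂_subset hsub) measure_closedBall_lt_top.ne
      _ = R ^ Module.finrank ℝ E * ω := volume_closedBall y hR
  rw [div_pow, le_div_iff₀ (by positivity)]
  nlinarith

/-! ### Matrices of bilinear forms -/

section Forms

variable {X : Type*} [MeasurableSpace X] {μ : Measure X}

theorem dotProduct_integral_mulVec {ι ι' : Type*} [Fintype ι] [Fintype ι'] (f : ι → ι' → X → ℝ)
    (hf : ∀ i j, Integrable (f i j) μ) (x : ι → ℝ) (y : ι' → ℝ) :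
    x ⬝ᵥ (Matrix.of fun i j => ∫ t, f i j t ∂μ) *ᵥ y =
      ∫ t, ∑ i, ∑ j, x i * (f i j t * y j) ∂μ := by
  have hint (i : ι) (j : ι') : Integrable (fun t => x i * (f i j t * y j)) μ :=
    ((hf i j).mul_const _).const_mul _
  rw [integral_finsetSum _ fun i _ => integrable_finsetSum _ fun j _ => hint i j]
  simp only [dotProduct, mulVec, Matrix.of_apply, Finset.mul_sum]
  refine Finset.sum_congr rfl fun i _ => ?_
  rw [integral_finsetSum _ fun j _ => hint i j]
  refine Finset.sum_congr rfl fun j _ => ?_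
  rw [integral_const_mul, integral_mul_const]

theorem dotProduct_integral_mul_mulVec {ι ι' : Type*} [Fintype ι] [Fintype ι'] {f : ι → X → ℝ}
    {g : ι' → X → ℝ} (hfg : ∀ i j, Integrable (fun t => f i t * g j t) μ)
    (x : ι → ℝ) (y : ι' → ℝ) :
    x ⬝ᵥ (Matrix.of fun i j => ∫ t, f i t * g j t ∂μ) *ᵥ y =
      ∫ t, (∑ i, x i * f i t) * ∑ j, y j * g j t ∂μ := by
  rw [dotProduct_integral_mulVec _ hfg]
  refine integral_congr_ae (.of_forall fun t => ?_)
  dsimp only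
  rw [Finset.sum_mul_sum]
  exact Finset.sum_congr rfl fun i _ => Finset.sum_congr rfl fun j _ => by ring

variable {ι : Type} [Fintype ι]

theorem sqNorm_integral_mul {f : ι → X → ℝ} (hf : ∀ i j, Integrable (fun t => f i t * f j t) μ)
    (x : ι → ℝ) :
    sqNorm (Matrix.of fun i j => ∫ t, f i t * f j t ∂μ) x = ∫ t, (∑ i, x i * f i t) ^ 2 ∂μ := by
  simp only [sqNorm, dotProduct_integral_mul_mulVec hf, pow_two]

theorem posDef_integral_mul {f : ι → X → ℝ} (hf : ∀ i j, Integrable (fun t => f i t * f j t) μ)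
    (hzero : ∀ x : ι → ℝ, ∫ t, (∑ i, x i * f i t) ^ 2 ∂μ = 0 → x = 0) :
    (Matrix.of fun i j => ∫ t, f i t * f j t ∂μ).PosDef := by
  refine .of_dotProduct_mulVec_pos (.ext fun i j => ?_) fun x hx => ?_
  · simp only [Matrix.of_apply, star_trivial, mul_comm]
  · rw [star_trivial]
    change 0 < sqNorm _ x
    rw [sqNorm_integral_mul hf]
    exact (integral_nonneg fun t => sq_nonneg _).lt_of_ne' fun h => hx (hzero x h)

theorem sqNorm_integral_mul_inner {E : Type*} [NormedAddCommGroup E] [InnerProductSpace ℝ E]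
    {a : X → ℝ} {G : ι → X → E} (hG : ∀ i j, Integrable (fun t => a t * inner ℝ (G i t) (G j t)) μ)
    (x : ι → ℝ) :
    sqNorm (Matrix.of fun i j => ∫ t, a t * inner ℝ (G i t) (G j t) ∂μ) x =
      ∫ t, a t * ‖∑ i, x i • G i t‖ ^ 2 ∂μ := by
  rw [sqNorm, dotProduct_integral_mulVec _ hG]
  refine integral_congr_ae (.of_forall fun t => ?_)
  simp only [← real_inner_self_eq_norm_sq, sum_inner, inner_sum, real_inner_smul_left,
    real_inner_smul_right, Finset.mul_sum]
  exact Finset.sum_congr rfl fun i _ => Finset.sum_congr rfl fun j _ => by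
    rw [real_inner_comm]; ring

theorem posSemidef_integral_mul_inner {κ : Type} [Finite κ] {E : Type*}
    [NormedAddCommGroup E] [InnerProductSpace ℝ E] {a : X → ℝ} {G : κ → X → E}
    (hG : ∀ i j, Integrable (fun t => a t * inner ℝ (G i t) (G j t)) μ)
    (ha : ∀ᵐ t ∂μ, 0 ≤ a t) :
    (Matrix.of fun i j => ∫ t, a t * inner ℝ (G i t) (G j t) ∂μ).PosSemidef := by
  have := Fintype.ofFinite κ
  refine .of_dotProduct_mulVec_nonneg (.ext fun i j => ?_) fun x => ?_
  · simp only [Matrix.of_apply, star_trivial, real_inner_comm]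
  · rw [star_trivial]
    change 0 ≤ sqNorm _ x
    rw [sqNorm_integral_mul_inner hG]
    exact integral_nonneg_of_ae (ha.mono fun t ht => mul_nonneg ht (sq_nonneg _))

end Forms

theorem gradient_sum_mul {F ι : Type*} [NormedAddCommGroup F] [InnerProductSpace ℝ F]
    [CompleteSpace F] {s : Finset ι} {c : ι → ℝ} {f : ι → F → ℝ} {x : F}
    (hf : ∀ i ∈ s, DifferentiableAt ℝ (f i) x) :
    gradient (fun y => ∑ i ∈ s, c i * f i y) x = ∑ i ∈ s, c i • gradient (f i) x := by
  rw [gradient, fderiv_fun_sum fun i hi => (hf i hi).const_mul _, map_sum]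
  refine Finset.sum_congr rfl fun i hi => ?_
  rw [fderiv_const_mul (hf i hi), map_smulₛₗ]
  rfl

theorem measurable_gradient {F : Type*} [NormedAddCommGroup F] [InnerProductSpace ℝ F]
    [CompleteSpace F] [MeasurableSpace F] [BorelSpace F] (f : F → ℝ) :
    Measurable (gradient f) :=
  (LinearIsometryEquiv.continuous _).measurable.comp (measurable_fderiv ℝ f)

namespace BulkSurfaceFE

variable {d k : ℕ} (D : BulkSurfaceFE d k) {s : Finset (Euc d)}

/-! ### Meshes -/

theorem finite_cells : D.cells.Finite := D.finite_bulkMesh.subset fun _ hs => hs.1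

theorem closure_eq_iUnion_cells : closure D.Ω = ⋃ s ∈ D.cells, simplexHull s := by
  rw [← D.space_bulkMesh]
  refine Set.Subset.antisymm (fun x hx => ?_) (Set.iUnion₂_subset fun s hs =>
    D.bulkMesh.convexHull_subset_space hs.1)
  obtain ⟨s, hs, hxs⟩ := D.bulkMesh.mem_space_iff.1 hx
  obtain ⟨t, ht, hst, hcard⟩ := D.pure_bulkMesh s hs
  exact Set.mem_biUnion (⟨ht, hcard⟩ : t ∈ D.cells) (convexHull_mono (by exact_mod_cast hst) hxs)

theorem simplexHull_subset_closure (hs : s ∈ D.bulkMesh.faces) : simplexHull s ⊆ closure D.Ω :=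
  D.space_bulkMesh ▸ D.bulkMesh.convexHull_subset_space hs

theorem isCompact_closure : IsCompact (closure D.Ω) := by
  rw [closure_eq_iUnion_cells]
  exact D.finite_cells.isCompact_biUnion fun s _ => isCompact_simplexHull s

theorem isCompact_Γ : IsCompact D.Γ :=
  D.isCompact_closure.of_isClosed_subset isClosed_frontier frontier_subset_closure

theorem mem_surfFacets : s ∈ D.surfFacets ↔ s ∈ D.surfMesh.faces ∧ s.card = d := by
  simp [surfFacets]

theorem Γ_eq_iUnion_surfFacets : D.Γ = ⋃ s ∈ D.surfFacets, simplexHull s := by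
  rw [Γ, ← D.space_surfMesh]
  refine Set.Subset.antisymm (fun x hx => ?_) (Set.iUnion₂_subset fun s hs =>
    D.surfMesh.convexHull_subset_space (D.mem_surfFacets.1 hs).1)
  obtain ⟨s, hs, hxs⟩ := D.surfMesh.mem_space_iff.1 hx
  obtain ⟨t, ht, hst, hcard⟩ := D.pure_surfMesh s hs
  exact Set.mem_biUnion (D.mem_surfFacets.2 ⟨ht, hcard⟩)
    (convexHull_mono (by exact_mod_cast hst) hxs)

theorem diam_le_h (hs : s ∈ D.cells) : Metric.diam (simplexHull s) ≤ D.h :=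
  le_csSup (D.finite_cells.image _).bddAbove (Set.mem_image_of_mem _ hs)

theorem dist_le_h (hs : s ∈ D.bulkMesh.faces) {x y : Euc d} (hx : x ∈ simplexHull s)
    (hy : y ∈ simplexHull s) : dist x y ≤ D.h := by
  obtain ⟨t, ht, hst, hcard⟩ := D.pure_bulkMesh s hs
  have hsub : simplexHull s ⊆ simplexHull t := convexHull_mono (by exact_mod_cast hst)
  exact (Metric.dist_le_diam_of_mem (isCompact_simplexHull t).isBounded (hsub hx) (hsub hy)).trans
    (D.diam_le_h ⟨ht, hcard⟩)

theorem h_nonneg : 0 ≤ D.h :=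
  Real.sSup_nonneg (by rintro _ ⟨s, -, rfl⟩; exact Metric.diam_nonneg)

theorem h_pos (hd : d ≠ 0) (hs : s ∈ D.cells) : 0 < D.h := by
  obtain ⟨a, ha, b, hb, hab⟩ := Finset.one_lt_card.1 (show 1 < s.card by rw [hs.2]; omega)
  exact (dist_pos.2 hab).trans_le (D.dist_le_h hs.1 (subset_convexHull ℝ _ ha)
    (subset_convexHull ℝ _ hb))

theorem ae_mem_interior_cell :
    ∀ᵐ x ∂(volume.restrict D.Ω), ∃ s ∈ D.cells, x ∈ interior (simplexHull s) := by
  have hfrontier : ∀ᵐ x ∂(volume : Measure (Euc d)),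
      ∀ s ∈ D.cells, x ∉ frontier (simplexHull s) := by
    rw [ae_ball_iff D.finite_cells.countable]
    exact fun s _ => measure_eq_zero_iff_ae_notMem.1 ((convex_simplexHull s).addHaar_frontier _)
  filter_upwards [ae_restrict_of_ae hfrontier, ae_restrict_mem D.isOpen_Ω.measurableSet]
    with x hx hxΩ
  obtain ⟨s, hs, hxs⟩ := Set.mem_iUnion₂.1 (D.closure_eq_iUnion_cells ▸ subset_closure hxΩ)
  exact ⟨s, hs, by_contra fun hni => hx s hs ⟨subset_closure hxs, hni⟩⟩

/-! ### Finite element functions -/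

/-- The function in `V_h` with the coefficient vector `u`. -/
def bulkFun (u : Fin D.NI ⊕ Fin D.NB → ℝ) (x : Euc d) : ℝ := ∑ i, u i * D.φ i x

/-- The function in `Q_h` with the coefficient vector `p`. -/
def surfFun (p : Fin D.Np → ℝ) (x : Euc d) : ℝ := ∑ j, p j * D.q j x

theorem isPolyOn_bulkFun (u : Fin D.NI ⊕ Fin D.NB → ℝ) (hs : s ∈ D.bulkMesh.faces) :
    IsPolyOn k (D.bulkFun u) (simplexHull s) :=
  IsPolyOn.sum_mul _ u fun i => (D.φ_mem i).2 s hs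

theorem isPolyOn_surfFun (p : Fin D.Np → ℝ) (hs : s ∈ D.surfMesh.faces) :
    IsPolyOn D.ℓ (D.surfFun p) (simplexHull s) :=
  IsPolyOn.sum_mul _ p fun i => (D.q_mem i).2 s hs

theorem continuousOn_φ (i : Fin D.NI ⊕ Fin D.NB) : ContinuousOn (D.φ i) (closure D.Ω) :=
  D.space_bulkMesh ▸ (D.φ_mem i).1

theorem continuousOn_bulkFun (u : Fin D.NI ⊕ Fin D.NB → ℝ) :
    ContinuousOn (D.bulkFun u) (closure D.Ω) :=
  continuousOn_finsetSum _ fun i _ => continuousOn_const.mul (D.continuousOn_φ i)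

theorem continuousOn_q (j : Fin D.Np) : ContinuousOn (D.q j) D.Γ := by
  rw [Γ, ← D.space_surfMesh]
  exact (D.q_mem j).1

theorem continuousOn_surfFun (p : Fin D.Np → ℝ) : ContinuousOn (D.surfFun p) D.Γ :=
  continuousOn_finsetSum _ fun i _ => continuousOn_const.mul (D.continuousOn_q i)

theorem bulkFun_node (u : Fin D.NI ⊕ Fin D.NB → ℝ) (i : Fin D.NI ⊕ Fin D.NB) :
    D.bulkFun u (D.node i) = u i := by
  simp [bulkFun, D.φ_node]

theorem range_node : Set.range D.node = lagrangeNodes D.bulkMesh k := by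
  rw [Sum.range_eq, Set.union_comm, ← Set.inter_union_sdiff (lagrangeNodes D.bulkMesh k)]
  exact congrArg₂ _ D.range_node_inr D.range_node_inl

theorem node_inr_mem_Γ (i : Fin D.NB) : D.node (Sum.inr i) ∈ D.Γ :=
  (D.range_node_inr.subset (Set.mem_range_self i)).2

theorem node_inl_notMem_Γ (i : Fin D.NI) : D.node (Sum.inl i) ∉ D.Γ :=
  (D.range_node_inl.subset (Set.mem_range_self i)).2

theorem exists_node_eq (hs : s ∈ D.bulkMesh.faces) {m : Euc d → ℕ} (hm : ∑ a ∈ s, m a = k) :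
    ∃ i, D.node i = ∑ a ∈ s, ((m a : ℝ) / (k : ℝ)) • a :=
  D.range_node.superset ⟨s, hs, m, hm, rfl⟩

theorem sum_div_smul_mem_simplexHull (hk : 1 ≤ k) {m : Euc d → ℕ} (hm : ∑ a ∈ s, m a = k) :
    ∑ a ∈ s, ((m a : ℝ) / (k : ℝ)) • a ∈ simplexHull s := by
  refine (convex_convexHull ℝ _).sum_mem (fun a _ => by positivity) ?_
    fun a ha => subset_convexHull ℝ _ ha
  rw [← Finset.sum_div, ← Nat.cast_sum, hm, div_self (by positivity)]

theorem node_mem_closure (hk : 1 ≤ k) (i : Fin D.NI ⊕ Fin D.NB) : D.node i ∈ closure D.Ω := by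
  obtain ⟨s, hs, m, hm, hx⟩ := D.range_node.subset (Set.mem_range_self i)
  rw [hx]
  exact D.simplexHull_subset_closure hs (sum_div_smul_mem_simplexHull hk hm)

/-! ### The bulk matrices -/

theorem integrableOn_of_continuousOn_closure {f : Euc d → ℝ} (hf : ContinuousOn f (closure D.Ω)) :
    IntegrableOn f D.Ω :=
  (integrableOn_of_continuousOn_isCompact hf D.isCompact_closure
    D.isCompact_closure.measure_lt_top.ne).mono_set subset_closure

theorem sqNorm_Mu (x : Fin D.NI ⊕ Fin D.NB → ℝ) :
    sqNorm D.Mu x = ∫ t in D.Ω, D.bulkFun x t ^ 2 :=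
  sqNorm_integral_mul (fun i j => D.integrableOn_of_continuousOn_closure
    ((D.continuousOn_φ i).mul (D.continuousOn_φ j))) x

theorem bulkFun_eqOn_zero {u : Fin D.NI ⊕ Fin D.NB → ℝ}
    (hu : ∫ t in D.Ω, D.bulkFun u t ^ 2 = 0) : Set.EqOn (D.bulkFun u) 0 (closure D.Ω) := by
  have hcont := D.continuousOn_bulkFun u
  have hae : (fun t => D.bulkFun u t ^ 2) =ᵐ[volume.restrict D.Ω] 0 :=
    (integral_eq_zero_iff_of_nonneg (fun t => sq_nonneg _)
      (D.integrableOn_of_continuousOn_closure (hcont.pow 2))).1 hu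
  have hΩ : Set.EqOn (D.bulkFun u) 0 D.Ω :=
    Measure.eqOn_open_of_ae_eq (hae.mono fun t ht => pow_eq_zero_iff two_ne_zero |>.1 ht)
      D.isOpen_Ω (hcont.mono subset_closure) continuousOn_const
  exact hΩ.of_subset_closure hcont continuousOn_const subset_closure subset_rfl

theorem posDef_Mu (hk : 1 ≤ k) : D.Mu.PosDef := by
  refine posDef_integral_mul (fun i j => D.integrableOn_of_continuousOn_closure
    ((D.continuousOn_φ i).mul (D.continuousOn_φ j))) fun u hu => ?_
  ext i
  rw [← D.bulkFun_node u i, Pi.zero_apply]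
  exact D.bulkFun_eqOn_zero hu (D.node_mem_closure hk i)

theorem gradient_bulkFun (u : Fin D.NI ⊕ Fin D.NB → ℝ) (hs : s ∈ D.bulkMesh.faces)
    {x : Euc d} (hx : x ∈ interior (simplexHull s)) :
    gradient (D.bulkFun u) x = ∑ i, u i • gradient (D.φ i) x :=
  gradient_sum_mul fun i _ => ((D.φ_mem i).2 s hs).differentiableAt hx

theorem exists_norm_gradient_φ_le (i : Fin D.NI ⊕ Fin D.NB) :
    ∃ B, ∀ᵐ x ∂(volume.restrict D.Ω), ‖gradient (D.φ i) x‖ ≤ B := by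
  have hcell : ∀ s ∈ D.cells, ∃ B, ∀ x ∈ interior (simplexHull s), ‖gradient (D.φ i) x‖ ≤ B :=
    fun s hs => ((D.φ_mem i).2 s hs.1).exists_norm_gradient_le (isCompact_simplexHull s)
      (convex_simplexHull s)
  choose! B hB using hcell
  obtain ⟨M, hM⟩ := (D.finite_cells.image B).bddAbove
  refine ⟨M, ?_⟩
  filter_upwards [D.ae_mem_interior_cell] with x ⟨s, hs, hxs⟩
  exact (hB s hs x hxs).trans (hM (Set.mem_image_of_mem B hs))

theorem ae_nonneg_α : ∀ᵐ x ∂(volume.restrict D.Ω), 0 ≤ D.α x := by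
  obtain ⟨a₀, ha₀, a₁, ha⟩ := D.bounds_α
  exact ha.mono fun x hx => ha₀.le.trans hx.1

theorem integrableOn_α_mul_inner_gradient (i j : Fin D.NI ⊕ Fin D.NB) :
    IntegrableOn (fun x => D.α x * inner ℝ (gradient (D.φ i) x) (gradient (D.φ j) x)) D.Ω := by
  obtain ⟨a₀, ha₀, a₁, ha⟩ := D.bounds_α
  obtain ⟨B, hB⟩ := D.exists_norm_gradient_φ_le i
  obtain ⟨B', hB'⟩ := D.exists_norm_gradient_φ_le j
  refine .of_bound ((measure_mono subset_closure).trans_lt D.isCompact_closure.measure_lt_top)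
    (D.aesm_α.mul ((measurable_gradient _).inner (measurable_gradient _)).aestronglyMeasurable)
    (a₁ * (B * B')) ?_
  filter_upwards [ha, hB, hB'] with x hα hi hj
  have hα₀ := ha₀.le.trans hα.1
  rw [norm_mul, Real.norm_of_nonneg hα₀]
  refine mul_le_mul hα.2 ((norm_inner_le_norm _ _).trans ?_) (norm_nonneg _) (hα₀.trans hα.2)
  exact mul_le_mul hi hj (norm_nonneg _) ((norm_nonneg _).trans hi)

theorem posSemidef_Ku : D.Ku.PosSemidef :=
  posSemidef_integral_mul_inner D.integrableOn_α_mul_inner_gradient D.ae_nonneg_α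

theorem sqNorm_Ku (x : Fin D.NI ⊕ Fin D.NB → ℝ) :
    sqNorm D.Ku x = ∫ t in D.Ω, D.α t * ‖gradient (D.bulkFun x) t‖ ^ 2 := by
  rw [Ku, sqNorm_integral_mul_inner D.integrableOn_α_mul_inner_gradient]
  refine integral_congr_ae ?_
  filter_upwards [D.ae_mem_interior_cell] with t ⟨s, hs, hts⟩
  rw [D.gradient_bulkFun x hs.1 hts]

end BulkSurfaceFE

/-! ### Traces and the boundary matrices -/

namespace BulkSurfaceFE

variable {n k : ℕ} (D : BulkSurfaceFE (n + 1) k)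

/-- The facets of the triangulation of the bulk that are contained in the boundary. -/
def bdryFacets : Set (Finset (Euc (n + 1))) :=
  {s | s ∈ D.bulkMesh.faces ∧ s.card = n + 1 ∧ simplexHull s ⊆ D.Γ}

/-- The extension by zero at the interior nodes of a coefficient vector in `M_h`, which makes it a
coefficient vector in `V_h`. -/
def extend (w : Fin D.NB → ℝ) : Fin D.NI ⊕ Fin D.NB → ℝ := Sum.elim 0 w

theorem exists_bdryFacet {x : Euc (n + 1)} (hx : x ∈ D.Γ) :
    ∃ s ∈ D.bdryFacets, x ∈ simplexHull s := by
  rw [Γ, D.boundary_bulkMesh] at hx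
  obtain ⟨s, hs, hxs⟩ := Set.mem_iUnion₂.1 hx
  exact ⟨s, hs, hxs⟩

theorem euclideanHausdorffMeasure_Γ_lt_top : μHE[n] D.Γ < ⊤ := by
  rw [Γ_eq_iUnion_surfFacets]
  exact (measure_biUnion_finset_le _ _).trans_lt <| ENNReal.sum_lt_top.2 fun s hs =>
    euclideanHausdorffMeasure_simplexHull_lt_top
      (D.surfMesh.indep (D.mem_surfFacets.1 hs).1) (D.mem_surfFacets.1 hs).2

theorem integrable_surf_of_continuousOn {f : Euc (n + 1) → ℝ} (hf : ContinuousOn f D.Γ) :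
    Integrable f D.surf :=
  integrableOn_of_continuousOn_isCompact hf D.isCompact_Γ D.euclideanHausdorffMeasure_Γ_lt_top.ne

theorem continuousOn_φ_Γ (i : Fin D.NI ⊕ Fin D.NB) : ContinuousOn (D.φ i) D.Γ :=
  (D.continuousOn_φ i).mono frontier_subset_closure

theorem continuousOn_bulkFun_Γ (u : Fin D.NI ⊕ Fin D.NB → ℝ) : ContinuousOn (D.bulkFun u) D.Γ :=
  (D.continuousOn_bulkFun u).mono frontier_subset_closure

theorem setIntegral_sq_le_integral_surf {f : Euc (n + 1) → ℝ} (hf : ContinuousOn f D.Γ)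
    {S : Set (Euc (n + 1))} (hS : S ⊆ D.Γ) :
    ∫ x in S, f x ^ 2 ∂μHE[n] ≤ ∫ x, f x ^ 2 ∂D.surf :=
  setIntegral_mono_set (D.integrable_surf_of_continuousOn (hf.pow 2))
    (.of_forall fun x => sq_nonneg (f x)) hS.eventuallyLE

theorem eqOn_zero_of_integral_sq_surf_eq_zero {f : Euc (n + 1) → ℝ} (hf : ContinuousOn f D.Γ)
    (hint : ∫ x, f x ^ 2 ∂D.surf = 0) {s : Finset (Euc (n + 1))}
    (hs : AffineIndependent ℝ ((↑) : s → Euc (n + 1))) (hcard : s.card = n + 1)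
    (hsub : simplexHull s ⊆ D.Γ) {ℓ : ℕ} (hpoly : IsPolyOn ℓ f (simplexHull s)) :
    Set.EqOn f 0 (simplexHull s) :=
  hpoly.eqOn_zero_of_setIntegral_sq_eq_zero (isCompact_simplexHull s) (convex_simplexHull s)
    (euclideanHausdorffMeasure_simplexHull_pos hs hcard).ne'
    (euclideanHausdorffMeasure_simplexHull_lt_top hs hcard).ne
    (((D.setIntegral_sq_le_integral_surf hf hsub).trans_eq hint).antisymm
      (integral_nonneg fun x => sq_nonneg (f x)))

theorem bulkFun_extend (w : Fin D.NB → ℝ) (x : Euc (n + 1)) :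
    D.bulkFun (D.extend w) x = ∑ i, w i * D.φ (Sum.inr i) x := by
  simp [bulkFun, extend]

theorem sqNorm_Mlam (w : Fin D.NB → ℝ) :
    sqNorm D.Mlam w = ∫ x, D.bulkFun (D.extend w) x ^ 2 ∂D.surf := by
  simp only [bulkFun_extend]
  exact sqNorm_integral_mul (fun i j => D.integrable_surf_of_continuousOn
    ((D.continuousOn_φ_Γ _).mul (D.continuousOn_φ_Γ _))) w

theorem posDef_Mlam : D.Mlam.PosDef := by
  refine posDef_integral_mul (fun i j => D.integrable_surf_of_continuousOn
    ((D.continuousOn_φ_Γ _).mul (D.continuousOn_φ_Γ _))) fun w hw => ?_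
  simp only [← bulkFun_extend] at hw
  ext i
  obtain ⟨s, hs, hxs⟩ := D.exists_bdryFacet (D.node_inr_mem_Γ i)
  have hzero := D.eqOn_zero_of_integral_sq_surf_eq_zero (D.continuousOn_bulkFun_Γ _) hw
    (D.bulkMesh.indep hs.1) hs.2.1 hs.2.2 (D.isPolyOn_bulkFun _ hs.1) hxs
  rwa [bulkFun_node] at hzero

theorem sqNorm_Mp (p : Fin D.Np → ℝ) : sqNorm D.Mp p = ∫ x, D.surfFun p x ^ 2 ∂D.surf :=
  sqNorm_integral_mul (fun i j => D.integrable_surf_of_continuousOn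
    ((D.continuousOn_q i).mul (D.continuousOn_q j))) p

theorem posDef_Mp : D.Mp.PosDef := by
  refine posDef_integral_mul (fun i j => D.integrable_surf_of_continuousOn
    ((D.continuousOn_q i).mul (D.continuousOn_q j))) fun p hp => ?_
  refine funext (Fintype.linearIndependent_iff.1 D.q_indep p (funext fun ⟨x, hx⟩ => ?_))
  obtain ⟨s, hs, hxs⟩ := Set.mem_iUnion₂.1 (D.Γ_eq_iUnion_surfFacets.subset hx)
  have hface := D.mem_surfFacets.1 hs
  have hzero := D.eqOn_zero_of_integral_sq_surf_eq_zero (D.continuousOn_surfFun p) hp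
    (D.surfMesh.indep hface.1) hface.2
    (Set.iUnion₂_subset_iff.1 D.Γ_eq_iUnion_surfFacets.superset s hs)
    (D.isPolyOn_surfFun p hface.1) hxs
  simpa [surfFun] using hzero

theorem dotProduct_Bp_mulVec (w : Fin D.NB → ℝ) (p : Fin D.Np → ℝ) :
    w ⬝ᵥ D.Bp *ᵥ p = ∫ x, D.bulkFun (D.extend w) x * D.surfFun p x ∂D.surf := by
  simp only [bulkFun_extend]
  exact dotProduct_integral_mul_mulVec (fun i j => D.integrable_surf_of_continuousOn
    ((D.continuousOn_φ_Γ _).mul (D.continuousOn_q j))) w p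

theorem two_mul_dotProduct_Bp_mulVec_le (w : Fin D.NB → ℝ) (p : Fin D.Np → ℝ) :
    2 * (w ⬝ᵥ D.Bp *ᵥ p) ≤ sqNorm D.Mlam w + sqNorm D.Mp p := by
  have hw := D.continuousOn_bulkFun_Γ (D.extend w)
  have hp := D.continuousOn_surfFun p
  have hw_sq : Integrable (fun x => D.bulkFun (D.extend w) x ^ 2) D.surf :=
    D.integrable_surf_of_continuousOn (hw.pow 2)
  have hp_sq : Integrable (fun x => D.surfFun p x ^ 2) D.surf :=
    D.integrable_surf_of_continuousOn (hp.pow 2)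
  rw [dotProduct_Bp_mulVec, sqNorm_Mlam, sqNorm_Mp, ← integral_const_mul,
    ← integral_add hw_sq hp_sq]
  refine integral_mono ((D.integrable_surf_of_continuousOn (hw.mul hp)).const_mul 2)
    (hw_sq.add hp_sq) fun x => ?_
  dsimp only
  rw [← mul_assoc]
  exact two_mul_le_add_sq _ _

/-- Matching traces is an `L²(Γ)`-orthogonal projection of `Q_h` into `M_h`. -/
theorem sqNorm_Mlam_le_sqNorm_Mp {w : Fin D.NB → ℝ} {p : Fin D.Np → ℝ}
    (hwp : D.Mlam *ᵥ w = D.Bp *ᵥ p) : sqNorm D.Mlam w ≤ sqNorm D.Mp p := by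
  have hyoung := D.two_mul_dotProduct_Bp_mulVec_le w p
  rw [← hwp] at hyoung
  change 2 * sqNorm D.Mlam w ≤ _ at hyoung
  linarith

theorem φ_inl_eq_zero (hk : 1 ≤ k) (i : Fin D.NI) {x : Euc (n + 1)} (hx : x ∈ D.Γ) :
    D.φ (Sum.inl i) x = 0 := by
  obtain ⟨s, hs, hxs⟩ := D.exists_bdryFacet hx
  obtain ⟨C, -, hC⟩ := exists_abs_le_of_nodes n hk
  have hnode (m : Euc (n + 1) → ℕ) (hm : ∑ a ∈ s, m a = k) :
      |D.φ (Sum.inl i) (∑ a ∈ s, ((m a : ℝ) / k) • a)| ≤ 0 := by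
    obtain ⟨j | j, hj⟩ := D.exists_node_eq hs.1 hm
    · exact absurd (hj ▸ hs.2.2 (sum_div_smul_mem_simplexHull hk hm)) (D.node_inl_notMem_Γ j)
    · simp [← hj, D.φ_node]
  have hle := hC (n + 1) s hs.2.1 _ ((D.φ_mem _).2 s hs.1) 0 hnode x hxs
  rwa [mul_zero, abs_nonpos_iff] at hle

theorem Bu_mulVec (hk : 1 ≤ k) (u : Fin D.NI ⊕ Fin D.NB → ℝ) :
    D.Bu *ᵥ u = D.Mlam *ᵥ (u ∘ Sum.inr) := by
  have hinl (i : Fin D.NB) (j : Fin D.NI) : D.Bu i (Sum.inl j) = 0 :=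
    setIntegral_eq_zero_of_forall_eq_zero fun x hx => by rw [D.φ_inl_eq_zero hk j hx, mul_zero]
  ext i
  simp only [mulVec, dotProduct, Fintype.sum_sum_type, hinl, zero_mul, Finset.sum_const_zero,
    zero_add]
  rfl

end BulkSurfaceFE

/-! ### Functions without interior degrees of freedom -/

theorem setIntegral_le_sum_measureReal_mul {X ι : Type*} [MeasurableSpace X] {μ : Measure X}
    {I : Finset ι} {S : Set X} {T : ι → Set X} (hT : ∀ i ∈ I, MeasurableSet (T i))
    (hfin : ∀ i ∈ I, μ (T i) ≠ ⊤) {c : ι → ℝ} (hc : ∀ i ∈ I, 0 ≤ c i) {g : X → ℝ}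
    (hg₀ : 0 ≤ᵐ[μ.restrict S] g) (hg : ∀ᵐ x ∂μ.restrict S, ∃ i ∈ I, x ∈ T i ∧ g x ≤ c i) :
    ∫ x in S, g x ∂μ ≤ ∑ i ∈ I, μ.real (T i) * c i := by
  set b : ι → X → ℝ := fun i => (T i).indicator fun _ => c i
  have hb (i : ι) (hi : i ∈ I) : Integrable (b i) μ :=
    (integrable_indicator_iff (hT i hi)).2 (integrableOn_const (hfin i hi))
  have hb₀ (x : X) (i : ι) (hi : i ∈ I) : 0 ≤ b i x := Set.indicator_nonneg (fun _ _ => hc i hi) x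
  have hsum : Integrable (fun x => ∑ i ∈ I, b i x) μ := integrable_finsetSum _ hb
  calc ∫ x in S, g x ∂μ ≤ ∫ x in S, ∑ i ∈ I, b i x ∂μ := by
        refine integral_mono_of_nonneg hg₀ hsum.integrableOn ?_
        filter_upwards [hg] with x ⟨i, hi, hxi, hgi⟩
        calc g x ≤ b i x := hgi.trans_eq (Set.indicator_of_mem hxi fun _ => c i).symm
          _ ≤ ∑ i ∈ I, b i x := Finset.single_le_sum (hb₀ x) hi
    _ ≤ ∫ x, ∑ i ∈ I, b i x ∂μ :=
        setIntegral_le_integral hsum (.of_forall fun x => Finset.sum_nonneg (hb₀ x))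
    _ = ∑ i ∈ I, μ.real (T i) * c i := by
        rw [integral_finsetSum _ hb]
        refine Finset.sum_congr rfl fun i hi => ?_
        rw [integral_indicator (hT i hi), setIntegral_const, smul_eq_mul]

theorem addHaar_real_closedBall_zero_one_pos {E : Type*} [NormedAddCommGroup E] [NormedSpace ℝ E]
    [FiniteDimensional ℝ E] [MeasurableSpace E] [BorelSpace E] (μ : Measure E)
    [μ.IsAddHaarMeasure] : 0 < μ.real (Metric.closedBall 0 1) :=
  ENNReal.toReal_pos (Metric.measure_closedBall_pos _ _ one_pos).ne' measure_closedBall_lt_top.ne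

namespace BulkSurfaceFE

variable {n k : ℕ} (D : BulkSurfaceFE (n + 1) k) {s : Finset (Euc (n + 1))} {σ : ℝ}

/-- The points whose closed `2h`-neighbourhood contains the cell `s`. -/
def near (s : Finset (Euc (n + 1))) : Set (Euc (n + 1)) :=
  {y | simplexHull s ⊆ Metric.closedBall y (2 * D.h)}

/-- The squared `L²(Γ)` norm of `v` near the cell `s`.  It replaces the norm on the boundary facets
that touch `s`, which would require counting the neighbours of a cell. -/
noncomputable def nearNorm (v : Euc (n + 1) → ℝ) (s : Finset (Euc (n + 1))) : ℝ :=
  ∫ y in D.near s, v y ^ 2 ∂D.surf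

theorem measurableSet_near (s : Finset (Euc (n + 1))) : MeasurableSet (D.near s) := by
  have hnear : D.near s = ⋂ z ∈ simplexHull s, Metric.closedBall z (2 * D.h) := by
    ext y
    simp [near, Set.subset_def, dist_comm]
  rw [hnear]
  exact (isClosed_biInter fun z _ => Metric.isClosed_closedBall).measurableSet

theorem nearNorm_nonneg (v : Euc (n + 1) → ℝ) (s : Finset (Euc (n + 1))) : 0 ≤ D.nearNorm v s :=
  integral_nonneg fun _ => sq_nonneg _

theorem pow_mul_le_measureReal_bdryFacet (hσ : 0 < σ) (hD : D.QuasiUniform σ)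
    {F : Finset (Euc (n + 1))} (hF : F ∈ D.bdryFacets) :
    (σ * D.h) ^ n * volume.real (Metric.closedBall (0 : Euc n) 1) ≤
      μHE[n].real (simplexHull F) := by
  classical
  obtain ⟨t, ht, hFt, hcard⟩ := D.pure_bulkMesh F hF.1
  obtain ⟨a, haF, rfl⟩ : ∃ a ∉ F, insert a F = t :=
    Finset.exists_eq_insert_iff.2 ⟨hFt, by rw [hcard, hF.2.1]⟩
  obtain ⟨c, hc⟩ := hD _ ⟨ht, hcard⟩
  have hvol := volume_closedBall_le_measure_facet (Finset.card_pos.1 (by rw [hF.2.1]; omega)) haF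
    (by simpa [simplexHull] using hc)
  have hreal := ENNReal.toReal_mono
    (euclideanHausdorffMeasure_simplexHull_lt_top (D.bulkMesh.indep hF.1) hF.2.1).ne hvol
  have hr : 0 ≤ σ * D.h := mul_nonneg hσ.le D.h_nonneg
  rwa [Measure.addHaar_closedBall' _ _ hr, finrank_euclideanSpace_fin, ENNReal.toReal_mul,
    ENNReal.toReal_ofReal (pow_nonneg hr n)] at hreal

theorem simplexHull_subset_near (hs : s ∈ D.bulkMesh.faces) {F : Finset (Euc (n + 1))}
    (hF : F ∈ D.bulkMesh.faces) {y : Euc (n + 1)} (hys : y ∈ simplexHull s)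
    (hyF : y ∈ simplexHull F) : simplexHull F ⊆ D.near s := fun z hz x hx =>
  (dist_triangle x y z).trans
    ((add_le_add (D.dist_le_h hs hx hys) (D.dist_le_h hF hyF hz)).trans_eq (two_mul _).symm)

theorem bulkFun_sq_mul_le_nearNorm (hσ : 0 < σ) (hD : D.QuasiUniform σ)
    (u : Fin D.NI ⊕ Fin D.NB → ℝ) (hs : s ∈ D.bulkMesh.faces) {y : Euc (n + 1)}
    (hys : y ∈ simplexHull s) (hy : y ∈ D.Γ) :
    D.bulkFun u y ^ 2 * ((σ * D.h) ^ n * volume.real (Metric.closedBall (0 : Euc n) 1)) ≤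
      inverseConst n k * D.nearNorm (D.bulkFun u) s := by
  obtain ⟨F, hF, hyF⟩ := D.exists_bdryFacet hy
  have hfin := (euclideanHausdorffMeasure_simplexHull_lt_top (D.bulkMesh.indep hF.1) hF.2.1).ne
  have hint : IntegrableOn (fun z => D.bulkFun u z ^ 2) D.Γ μHE[n] :=
    D.integrable_surf_of_continuousOn ((D.continuousOn_bulkFun_Γ u).pow 2)
  calc _ ≤ D.bulkFun u y ^ 2 * μHE[n].real (simplexHull F) := by
        gcongr
        exact D.pow_mul_le_measureReal_bdryFacet hσ hD hF
    _ ≤ inverseConst n k * ∫ z in simplexHull F, D.bulkFun u z ^ 2 ∂μHE[n] :=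
        (D.isPolyOn_bulkFun u hF.1).sq_mul_measureReal_le (isCompact_simplexHull F)
          (convex_simplexHull F) hfin hyF
    _ ≤ inverseConst n k * ∫ z in D.near s ∩ D.Γ, D.bulkFun u z ^ 2 ∂μHE[n] := by
        gcongr ?_ * ?_
        · exact (inverseConst_pos n k).le
        · exact setIntegral_mono_set (hint.mono_set Set.inter_subset_right)
            (.of_forall fun z => sq_nonneg _)
            (Set.subset_inter (D.simplexHull_subset_near hs hF.1 hys hyF) hF.2.2).eventuallyLE
    _ = inverseConst n k * D.nearNorm (D.bulkFun u) s := by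
        rw [nearNorm, surf, Measure.restrict_restrict (D.measurableSet_near s), Nat.add_sub_cancel]

/-- The interior nodal values vanish and the boundary nodal values are controlled by the trace near
the cell, because every boundary node lies on a boundary facet. -/
theorem exists_bulkFun_extend_sq_le (n : ℕ) {k : ℕ} (hk : 1 ≤ k) {σ : ℝ} (hσ : 0 < σ) :
    ∃ C > 0, ∀ D : BulkSurfaceFE (n + 1) k, D.QuasiUniform σ → ∀ w : Fin D.NB → ℝ,
      ∀ s ∈ D.cells, ∀ x ∈ simplexHull s,
        D.bulkFun (D.extend w) x ^ 2 ≤ C / D.h ^ n * D.nearNorm (D.bulkFun (D.extend w)) s := by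
  obtain ⟨CA, hCA, hnodes⟩ := exists_abs_le_of_nodes (n + 1) hk
  have hω := addHaar_real_closedBall_zero_one_pos (volume : Measure (Euc n))
  set ω := volume.real (Metric.closedBall (0 : Euc n) 1)
  have hCI := inverseConst_pos n k
  refine ⟨CA ^ 2 * (inverseConst n k / (σ ^ n * ω)), by positivity, fun D hD w s hs x hx => ?_⟩
  have hh := D.h_pos n.succ_ne_zero hs
  have hJ := D.nearNorm_nonneg (D.bulkFun (D.extend w)) s
  set v := D.bulkFun (D.extend w)
  set B := inverseConst n k * D.nearNorm v s / ((σ * D.h) ^ n * ω)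
  have hB : 0 ≤ B := by positivity
  have hlattice (m : Euc (n + 1) → ℕ) (hm : ∑ a ∈ s, m a = k) :
      |v (∑ a ∈ s, ((m a : ℝ) / k) • a)| ≤ √B := by
    have hmem := sum_div_smul_mem_simplexHull hk hm
    obtain ⟨i | i, hi⟩ := D.exists_node_eq hs.1 hm <;> rw [← hi] at hmem ⊢
    · simp [v, bulkFun_node, extend]
    · refine Real.abs_le_sqrt ((le_div_iff₀ (by positivity)).2 ?_)
      exact D.bulkFun_sq_mul_le_nearNorm hσ hD _ hs.1 hmem (D.node_inr_mem_Γ i)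
  calc v x ^ 2 = |v x| ^ 2 := (sq_abs _).symm
    _ ≤ (CA * √B) ^ 2 := by
        gcongr
        exact hnodes (n + 1) s hs.2 v (D.isPolyOn_bulkFun _ hs.1) _ hlattice x hx
    _ = _ := by
        rw [mul_pow, Real.sq_sqrt hB]
        simp only [B, mul_pow]
        field_simp

theorem card_cells_filter_near_le [∀ y, DecidablePred fun s => y ∈ D.near s] (hσ : 0 < σ)
    (hD : D.QuasiUniform σ) (y : Euc (n + 1)) :
    ((D.finite_cells.toFinset.filter fun s => y ∈ D.near s).card : ℝ) ≤ (2 / σ) ^ (n + 1) := by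
  set I := D.finite_cells.toFinset.filter fun s => y ∈ D.near s
  have hI {s} (hs : s ∈ I) : s ∈ D.cells ∧ y ∈ D.near s := by simpa [I] using hs
  rcases I.eq_empty_or_nonempty with hempty | ⟨s, hs⟩
  · rw [hempty, Finset.card_empty, Nat.cast_zero]
    positivity
  have hh := D.h_pos n.succ_ne_zero (hI hs).1
  have hcard := card_le_of_closedBall_subset volume I simplexHull
    (fun s _ => (isCompact_simplexHull s).measurableSet)
    (fun s hs t ht hst => volume_simplexHull_inter_eq_zero (hI hs).1.1 (hI ht).1.1
      ((hI hs).1.2.trans (hI ht).1.2.symm) hst)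
    (mul_pos hσ hh) (mul_nonneg zero_le_two hh.le) (fun s hs => hD s (hI hs).1)
    fun s hs => (hI hs).2
  rwa [mul_div_mul_right _ _ hh.ne', finrank_euclideanSpace_fin] at hcard

theorem sum_nearNorm_le (hσ : 0 < σ) (hD : D.QuasiUniform σ) {v : Euc (n + 1) → ℝ}
    (hv : ContinuousOn v D.Γ) :
    ∑ s ∈ D.finite_cells.toFinset, D.nearNorm v s ≤
      (2 / σ) ^ (n + 1) * ∫ y, v y ^ 2 ∂D.surf := by
  classical
  have hint : Integrable (fun y => v y ^ 2) D.surf :=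
    D.integrable_surf_of_continuousOn (hv.pow 2)
  simp only [nearNorm, ← integral_indicator (D.measurableSet_near _)]
  rw [← integral_finsetSum _ fun s _ => hint.indicator (D.measurableSet_near s),
    ← integral_const_mul]
  refine integral_mono (integrable_finsetSum _ fun s _ => hint.indicator (D.measurableSet_near s))
    (hint.const_mul _) fun y => ?_
  calc ∑ s ∈ D.finite_cells.toFinset, (D.near s).indicator (fun y => v y ^ 2) y
      = (D.finite_cells.toFinset.filter fun s => y ∈ D.near s).card * v y ^ 2 := by
        simp only [Set.indicator_apply, ← Finset.sum_filter, Finset.sum_const, nsmul_eq_mul]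
    _ ≤ (2 / σ) ^ (n + 1) * v y ^ 2 := by
        gcongr
        exact D.card_cells_filter_near_le hσ hD y

theorem measureReal_cell_le (hs : s ∈ D.cells) : volume.real (simplexHull s) ≤
    D.h ^ (n + 1) * volume.real (Metric.closedBall (0 : Euc (n + 1)) 1) := by
  obtain ⟨a, ha⟩ : s.Nonempty := Finset.card_pos.1 (by rw [hs.2]; omega)
  have hsub : simplexHull s ⊆ Metric.closedBall a D.h := fun x hx =>
    D.dist_le_h hs.1 hx (subset_convexHull ℝ _ ha)
  refine (measureReal_mono hsub measure_closedBall_lt_top.ne).trans_eq ?_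
  rw [Measure.addHaar_real_closedBall' _ _ D.h_nonneg, finrank_euclideanSpace_fin]

theorem integral_le_of_le_nearNorm (hσ : 0 < σ) (hD : D.QuasiUniform σ)
    {v : Euc (n + 1) → ℝ} (hv : ContinuousOn v D.Γ) {A : ℝ} (hA : 0 ≤ A) {g : Euc (n + 1) → ℝ}
    (hg₀ : 0 ≤ᵐ[volume.restrict D.Ω] g) (hg : ∀ᵐ x ∂(volume.restrict D.Ω),
      ∀ s ∈ D.cells, x ∈ interior (simplexHull s) → g x ≤ A * D.nearNorm v s) :
    ∫ x in D.Ω, g x ≤ D.h ^ (n + 1) * volume.real (Metric.closedBall (0 : Euc (n + 1)) 1) *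
      (A * ((2 / σ) ^ (n + 1) * ∫ y, v y ^ 2 ∂D.surf)) := by
  have hnn (s) : 0 ≤ A * D.nearNorm v s := mul_nonneg hA (D.nearNorm_nonneg v s)
  have hcover : ∀ᵐ x ∂(volume.restrict D.Ω), ∃ s ∈ D.finite_cells.toFinset,
      x ∈ simplexHull s ∧ g x ≤ A * D.nearNorm v s := by
    filter_upwards [hg, D.ae_mem_interior_cell] with x hx ⟨s, hs, hxs⟩
    exact ⟨s, D.finite_cells.mem_toFinset.2 hs, interior_subset hxs, hx s hs hxs⟩
  refine (setIntegral_le_sum_measureReal_mul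
    (fun s _ => (isCompact_simplexHull s).measurableSet)
    (fun s _ => (isCompact_simplexHull s).measure_lt_top.ne) (fun s _ => hnn s) hg₀ hcover).trans ?_
  calc ∑ s ∈ D.finite_cells.toFinset, volume.real (simplexHull s) * (A * D.nearNorm v s)
      ≤ ∑ s ∈ D.finite_cells.toFinset,
          D.h ^ (n + 1) * volume.real (Metric.closedBall (0 : Euc (n + 1)) 1) *
            (A * D.nearNorm v s) :=
        Finset.sum_le_sum fun s hs => mul_le_mul_of_nonneg_right
          (D.measureReal_cell_le (D.finite_cells.mem_toFinset.1 hs)) (hnn s)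
    _ ≤ _ := by
        rw [← Finset.mul_sum, ← Finset.mul_sum]
        have hh := D.h_nonneg
        gcongr
        exact D.sum_nearNorm_le hσ hD hv

theorem exists_sqNorm_Mu_extend_le (n : ℕ) {k : ℕ} (hk : 1 ≤ k) {σ : ℝ} (hσ : 0 < σ) :
    ∃ cM > 0, ∀ D : BulkSurfaceFE (n + 1) k, D.QuasiUniform σ → ∀ w : Fin D.NB → ℝ,
      sqNorm D.Mu (D.extend w) ≤ cM * D.h * sqNorm D.Mlam w := by
  obtain ⟨C, hC, hlocal⟩ := exists_bulkFun_extend_sq_le n hk hσ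
  have hω := addHaar_real_closedBall_zero_one_pos (volume : Measure (Euc (n + 1)))
  set ω := volume.real (Metric.closedBall (0 : Euc (n + 1)) 1)
  refine ⟨ω * C * (2 / σ) ^ (n + 1), by positivity, fun D hD w => ?_⟩
  have hh := D.h_nonneg
  have hscale : D.h ^ (n + 1) * (C / D.h ^ n) = C * D.h := by
    rcases hh.eq_or_lt with h0 | h0
    · simp [← h0]
    · field_simp
      ring
  rw [sqNorm_Mu, sqNorm_Mlam]
  refine (D.integral_le_of_le_nearNorm hσ hD (D.continuousOn_bulkFun_Γ (D.extend w))
    (by positivity : 0 ≤ C / D.h ^ n) (.of_forall fun x => sq_nonneg _)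
    (.of_forall fun x s hs hx => hlocal D hD w s hs x (interior_subset hx))).trans_eq ?_
  linear_combination ω * ((2 / σ) ^ (n + 1) * ∫ y, D.bulkFun (D.extend w) y ^ 2 ∂D.surf) * hscale

theorem exists_norm_gradient_bulkFun_extend_sq_le (n : ℕ) {k : ℕ} (hk : 1 ≤ k) {σ : ℝ}
    (hσ : 0 < σ) : ∃ C > 0, ∀ D : BulkSurfaceFE (n + 1) k, D.QuasiUniform σ →
      ∀ w : Fin D.NB → ℝ, ∀ s ∈ D.cells, ∀ x ∈ interior (simplexHull s),
        ‖gradient (D.bulkFun (D.extend w)) x‖ ^ 2 ≤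
          C / D.h ^ (n + 2) * D.nearNorm (D.bulkFun (D.extend w)) s := by
  obtain ⟨C, hC, hlocal⟩ := exists_bulkFun_extend_sq_le n hk hσ
  have hmarkov := markovConst_pos k
  refine ⟨markovConst k ^ 2 * C / σ ^ 2, by positivity, fun D hD w s hs x hx => ?_⟩
  have hh := D.h_pos n.succ_ne_zero hs
  have hJ := D.nearNorm_nonneg (D.bulkFun (D.extend w)) s
  obtain ⟨c, hc⟩ := hD s hs
  have hgrad := (D.isPolyOn_bulkFun (D.extend w) hs.1).norm_gradient_le (convex_simplexHull s)
    (fun y hy => Real.abs_le_sqrt (hlocal D hD w s hs y hy)) (mul_pos hσ hh) hc hx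
  refine (pow_le_pow_left₀ (norm_nonneg _) hgrad 2).trans_eq ?_
  rw [div_pow, mul_pow, Real.sq_sqrt (by positivity)]
  field_simp
  ring

theorem exists_sqNorm_Ku_extend_le (n : ℕ) {k : ℕ} (hk : 1 ≤ k) {σ : ℝ} (hσ : 0 < σ) {αmax : ℝ}
    (hα : 0 < αmax) : ∃ cK > 0, ∀ D : BulkSurfaceFE (n + 1) k, D.QuasiUniform σ →
      (∀ᵐ x ∂(volume.restrict D.Ω), D.α x ≤ αmax) → ∀ w : Fin D.NB → ℝ,
      sqNorm D.Ku (D.extend w) ≤ cK * D.h⁻¹ * sqNorm D.Mlam w := by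
  obtain ⟨C, hC, hgrad⟩ := exists_norm_gradient_bulkFun_extend_sq_le n hk hσ
  have hω := addHaar_real_closedBall_zero_one_pos (volume : Measure (Euc (n + 1)))
  set ω := volume.real (Metric.closedBall (0 : Euc (n + 1)) 1)
  refine ⟨ω * (αmax * C) * (2 / σ) ^ (n + 1), by positivity, fun D hD hDα w => ?_⟩
  have hh := D.h_nonneg
  have hscale : D.h ^ (n + 1) * (αmax * (C / D.h ^ (n + 2))) = αmax * C * D.h⁻¹ := by
    rcases hh.eq_or_lt with h0 | h0
    · simp [← h0]
    · field_simp
      ring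
  rw [sqNorm_Ku, sqNorm_Mlam]
  refine (D.integral_le_of_le_nearNorm hσ hD (D.continuousOn_bulkFun_Γ (D.extend w))
    (by positivity : 0 ≤ αmax * (C / D.h ^ (n + 2)))
    (D.ae_nonneg_α.mono fun x hx => mul_nonneg hx (sq_nonneg _)) ?_).trans_eq ?_
  · filter_upwards [hDα] with x hxα s hs hx
    rw [mul_assoc]
    exact mul_le_mul hxα (hgrad D hD w s hs x hx) (sq_nonneg _) hα.le
  · linear_combination
      ω * ((2 / σ) ^ (n + 1) * ∫ y, D.bulkFun (D.extend w) y ^ 2 ∂D.surf) * hscale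

theorem sqNorm_toBlocks₂₂ (A : Matrix (Fin D.NI ⊕ Fin D.NB) (Fin D.NI ⊕ Fin D.NB) ℝ)
    (w : Fin D.NB → ℝ) : sqNorm A.toBlocks₂₂ w = sqNorm A (D.extend w) := by
  simp [sqNorm, dotProduct, mulVec, Fintype.sum_sum_type, extend, toBlocks₂₂]

end BulkSurfaceFE

/-! ### Quadratic forms and difference quotients -/

theorem bdf2_eq_smul_bdiff {ι : Type} (τ : ℝ) (x : ℤ → ι → ℝ) (n : ℤ) :
    bdf2 τ x n = (1 / 2 : ℝ) • ((3 : ℝ) • τ⁻¹ • bdiff x n - τ⁻¹ • bdiff x (n - 1)) := by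
  simp only [bdf2, bdiff, sub_sub, Int.reduceAdd, one_div, mul_inv]
  module

section Quadratic

variable {ι : Type} [Fintype ι] {A : Matrix ι ι ℝ}

theorem dotProduct_mulVec_comm_of_isHermitian (hA : A.IsHermitian) (x y : ι → ℝ) :
    x ⬝ᵥ A *ᵥ y = y ⬝ᵥ A *ᵥ x := by
  rw [dotProduct_mulVec, ← mulVec_transpose, ← conjTranspose_eq_transpose_of_trivial, hA.eq,
    dotProduct_comm]

theorem sqNorm_sub (hA : A.IsHermitian) (x y : ι → ℝ) :
    sqNorm A (x - y) = sqNorm A x - 2 * (x ⬝ᵥ A *ᵥ y) + sqNorm A y := by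
  simp only [sqNorm, mulVec_sub, dotProduct_sub, sub_dotProduct]
  linear_combination -dotProduct_mulVec_comm_of_isHermitian hA y x

theorem sqNorm_smul (A : Matrix ι ι ℝ) (c : ℝ) (x : ι → ℝ) :
    sqNorm A (c • x) = c ^ 2 * sqNorm A x := by
  simp only [sqNorm, mulVec_smul, dotProduct_smul, smul_dotProduct, smul_eq_mul]
  ring

theorem sqNorm_nonneg (hA : A.PosSemidef) (x : ι → ℝ) : 0 ≤ sqNorm A x :=
  hA.dotProduct_mulVec_nonneg x

theorem two_mul_dotProduct_mulVec_le (hA : A.PosSemidef) (x y : ι → ℝ) :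
    2 * (x ⬝ᵥ A *ᵥ y) ≤ sqNorm A x + sqNorm A y := by
  linarith [sqNorm_sub hA.isHermitian x y, sqNorm_nonneg hA (x - y)]

theorem sqNorm_sub_le (hA : A.PosSemidef) (x y : ι → ℝ) :
    sqNorm A (x - y) ≤ 2 * (sqNorm A x + sqNorm A y) := by
  have hyoung := two_mul_dotProduct_mulVec_le hA x (-y)
  have hneg : sqNorm A (-y) = sqNorm A y := by simp only [sqNorm, mulVec_neg, neg_dotProduct_neg]
  rw [hneg, mulVec_neg, dotProduct_neg] at hyoung
  linarith [sqNorm_sub hA.isHermitian x y]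

theorem mulVec_inv_mulVec [DecidableEq ι] (hA : A.PosDef) (b : ι → ℝ) : A *ᵥ (A⁻¹ *ᵥ b) = b := by
  rw [mulVec_mulVec, mul_nonsing_inv _ ((isUnit_iff_isUnit_det A).1 hA.isUnit), one_mulVec]

theorem inv_mulVec_mulVec [DecidableEq ι] (hA : A.PosDef) (b : ι → ℝ) : A⁻¹ *ᵥ (A *ᵥ b) = b := by
  rw [mulVec_mulVec, nonsing_inv_mul _ ((isUnit_iff_isUnit_det A).1 hA.isUnit), one_mulVec]

theorem sqNorm_inv_mulVec [DecidableEq ι] (hA : A.PosDef) (f : ι → ℝ) :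
    sqNorm A (A⁻¹ *ᵥ f) = sqNorm A⁻¹ f := by
  rw [sqNorm, sqNorm, mulVec_inv_mulVec hA, dotProduct_comm]

variable {τ : ℝ}

theorem two_mul_dotProduct_le [DecidableEq ι] (hA : A.PosDef) (hτ : 0 < τ) (x f : ι → ℝ) :
    2 * (x ⬝ᵥ f) ≤ τ * (1 / 2 * sqNorm A (τ⁻¹ • x) + 2 * sqNorm A⁻¹ f) := by
  have hyoung := two_mul_dotProduct_mulVec_le hA.posSemidef (τ⁻¹ • x) ((2 : ℝ) • A⁻¹ *ᵥ f)
  rw [mulVec_smul, mulVec_inv_mulVec hA, sqNorm_smul A 2, sqNorm_inv_mulVec hA, dotProduct_smul,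
    smul_dotProduct, smul_eq_mul, smul_eq_mul] at hyoung
  calc 2 * (x ⬝ᵥ f) = τ / 2 * (2 * (2 * (τ⁻¹ * (x ⬝ᵥ f)))) := by field_simp
    _ ≤ τ / 2 * (sqNorm A (τ⁻¹ • x) + 2 ^ 2 * sqNorm A⁻¹ f) := by gcongr
    _ = _ := by ring

theorem two_mul_dotProduct_mulVec_sub_le (hA : A.PosSemidef) (hτ : 0 < τ) (x y z : ι → ℝ) :
    2 * (3 / (2 * τ) * (x ⬝ᵥ A *ᵥ (y - z))) ≤
      τ * (1 / 2 * sqNorm A (τ⁻¹ • x) + 9 * (sqNorm A (τ⁻¹ • y) + sqNorm A (τ⁻¹ • z))) := by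
  have hyoung := two_mul_dotProduct_mulVec_le hA (τ⁻¹ • x) ((3 : ℝ) • τ⁻¹ • (y - z))
  have hsub := sqNorm_sub_le hA (τ⁻¹ • y) (τ⁻¹ • z)
  rw [mulVec_smul, mulVec_smul, sqNorm_smul A 3, dotProduct_smul, dotProduct_smul,
    smul_dotProduct, smul_eq_mul, smul_eq_mul, smul_eq_mul, smul_sub] at hyoung
  calc 2 * (3 / (2 * τ) * (x ⬝ᵥ A *ᵥ (y - z)))
      = τ / 2 * (2 * (3 * (τ⁻¹ * (τ⁻¹ * (x ⬝ᵥ A *ᵥ (y - z)))))) := by field_simp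
    _ ≤ τ / 2 * (sqNorm A (τ⁻¹ • x) +
          3 ^ 2 * (2 * (sqNorm A (τ⁻¹ • y) + sqNorm A (τ⁻¹ • z)))) := by
        gcongr
        linarith
    _ = _ := by ring

theorem two_mul_dotProduct_mulVec_bdf2 (hA : A.IsHermitian) (hτ : τ ≠ 0) (x : ℤ → ι → ℝ) (n : ℤ) :
    2 * (bdiff x n ⬝ᵥ A *ᵥ bdf2 τ x n) =
      τ / 2 * (5 * sqNorm A (τ⁻¹ • bdiff x n) - sqNorm A (τ⁻¹ • bdiff x (n - 1)) +
        sqNorm A (τ⁻¹ • bdiff (bdiff x) n)) := by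
  have hsub := sqNorm_sub hA (τ⁻¹ • bdiff x n) (τ⁻¹ • bdiff x (n - 1))
  rw [← smul_sub, ← bdiff] at hsub
  nth_rw 1 [hsub, ← smul_inv_smul₀ hτ (bdiff x n)]
  rw [bdf2_eq_smul_bdiff]
  simp only [sqNorm, mulVec_smul _ (1 / 2 : ℝ), mulVec_smul _ (3 : ℝ), mulVec_sub,
    smul_dotProduct _ (τ⁻¹ • bdiff x n), dotProduct_smul, dotProduct_sub, smul_eq_mul]
  ring

theorem two_mul_dotProduct_mulVec_bdiff (hA : A.IsHermitian) (x : ℤ → ι → ℝ) (n : ℤ) :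
    2 * (bdiff x n ⬝ᵥ A *ᵥ x n) =
      sqNorm A (x n) - sqNorm A (x (n - 1)) + sqNorm A (bdiff x n) := by
  have hsub := sqNorm_sub hA (x n) (bdiff x n)
  rw [dotProduct_mulVec_comm_of_isHermitian hA, show x n - bdiff x n = x (n - 1) from
    sub_sub_cancel _ _] at hsub
  linarith

end Quadratic

theorem mulVec_sumElim {ι κ : Type*} [Fintype ι] [Fintype κ] (A : Matrix (ι ⊕ κ) (ι ⊕ κ) ℝ)
    (x : ι → ℝ) (y : κ → ℝ) : A *ᵥ Sum.elim x y =
      Sum.elim (A.toBlocks₁₁ *ᵥ x + A.toBlocks₁₂ *ᵥ y) (A.toBlocks₂₁ *ᵥ x + A.toBlocks₂₂ *ᵥ y) := by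
  conv_lhs => rw [← fromBlocks_toBlocks A, fromBlocks_mulVec, Sum.elim_comp_inl, Sum.elim_comp_inr]

namespace BulkSurfaceFE

/-! ### The scheme as a perturbed BDF-2 scheme -/

variable {n k : ℕ} (D : BulkSurfaceFE (n + 1) k)

theorem isHermitian_Kp : D.Kp.IsHermitian :=
  .ext fun i j => by simp only [Kp, Matrix.of_apply, star_trivial, real_inner_comm]

/-- The coefficients of the `L²(Γ)`-orthogonal projection of a function in `Q_h` to `M_h`. -/
noncomputable def traceProj : (Fin D.Np → ℝ) →ₗ[ℝ] Fin D.NB → ℝ :=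
  D.Mlam⁻¹.mulVecLin ∘ₗ D.Bp.mulVecLin

/-- The extension of `traceProj` by zero to the interior nodes. -/
noncomputable def lift : (Fin D.Np → ℝ) →ₗ[ℝ] Fin D.NI ⊕ Fin D.NB → ℝ where
  toFun p := D.extend (D.traceProj p)
  map_add' p q := by ext (i | i) <;> simp [extend]
  map_smul' c p := by ext (i | i) <;> simp [extend]

theorem traceProj_apply (p : Fin D.Np → ℝ) : D.traceProj p = D.Mlam⁻¹ *ᵥ (D.Bp *ᵥ p) := rfl

theorem Mlam_mulVec_traceProj (p : Fin D.Np → ℝ) : D.Mlam *ᵥ D.traceProj p = D.Bp *ᵥ p :=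
  mulVec_inv_mulVec D.posDef_Mlam _

theorem eq_traceProj {w : Fin D.NB → ℝ} {p : Fin D.Np → ℝ} (h : D.Mlam *ᵥ w = D.Bp *ᵥ p) :
    w = D.traceProj p := by
  rw [traceProj_apply, ← h, inv_mulVec_mulVec D.posDef_Mlam]

theorem dotProduct_extend_of_trace_eq {x : Fin D.NI ⊕ Fin D.NB → ℝ} {p : Fin D.Np → ℝ}
    (h : x ∘ Sum.inr = D.traceProj p) (w : Fin D.NB → ℝ) :
    x ⬝ᵥ D.extend (D.Mlam *ᵥ w) = p ⬝ᵥ D.Bpᵀ *ᵥ w := by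
  rw [← Sum.elim_comp_inl_inr x, extend, sumElim_dotProduct_sumElim, dotProduct_zero, zero_add, h,
    dotProduct_mulVec_comm_of_isHermitian D.posDef_Mlam.isHermitian, Mlam_mulVec_traceProj,
    mulVec_transpose, dotProduct_mulVec, dotProduct_comm]

namespace IsSolution

variable {D} {τ : ℝ} {fu : ℤ → Fin D.NI ⊕ Fin D.NB → ℝ} {fp : ℤ → Fin D.Np → ℝ}
  {u : ℤ → Fin D.NI ⊕ Fin D.NB → ℝ} {p : ℤ → Fin D.Np → ℝ} {lam : ℤ → Fin D.NB → ℝ}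

theorem trace_eq (hk : 1 ≤ k) (hS : D.IsSolution τ fu fp u p lam) {j : ℤ} (hj : -1 ≤ j) :
    u j ∘ Sum.inr = D.traceProj (p j) := by
  refine D.eq_traceProj ?_
  rcases (by omega : j = -1 ∨ j = 0 ∨ 1 ≤ j) with rfl | rfl | hj
  · rw [← D.Bu_mulVec hk, hS.consistent_neg_one]
  · rw [← D.Bu_mulVec hk, hS.consistent_zero]
  · exact hS.eq_trace j hj

theorem trace_bdiff_eq (hk : 1 ≤ k) (hS : D.IsSolution τ fu fp u p lam) {m : ℤ} (hm : 1 ≤ m) :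
    bdiff u m ∘ Sum.inr = D.traceProj (bdiff p m) := by
  rw [bdiff, bdiff, map_sub, ← hS.trace_eq hk (by omega), ← hS.trace_eq hk (by omega)]
  rfl

theorem sumElim_eq_sub_lift (hk : 1 ≤ k) (hS : D.IsSolution τ fu fp u p lam) {m : ℤ}
    (hm : 1 ≤ m) : Sum.elim (u m ∘ Sum.inl) (D.traceProj ((2 : ℝ) • p (m - 1) - p (m - 2))) =
      u m - D.lift (bdiff (bdiff p) m) := by
  have hextrapolate : (2 : ℝ) • p (m - 1) - p (m - 2) = p m - bdiff (bdiff p) m := by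
    simp only [bdiff, sub_sub, Int.reduceAdd]
    module
  rw [hextrapolate, map_sub, ← hS.trace_eq hk (by omega)]
  ext (i | i) <;> simp [lift, extend]

theorem sumElim_bdf2_eq_sub_lift (hk : 1 ≤ k) (hS : D.IsSolution τ fu fp u p lam) {m : ℤ}
    (hm : 1 ≤ m) :
    Sum.elim (bdf2 τ (fun j => u j ∘ Sum.inl) m) (D.traceProj (delayQuotient τ p m)) =
      bdf2 τ u m - (3 / (2 * τ)) • D.lift (bdiff (bdiff (bdiff p)) m) := by
  have hdelay : delayQuotient τ p m =
      bdf2 τ p m - (3 / (2 * τ)) • bdiff (bdiff (bdiff p)) m := by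
    simp only [delayQuotient, bdf2, bdiff, sub_sub, Int.reduceAdd]
    module
  have htrace : D.traceProj (bdf2 τ p m) = bdf2 τ u m ∘ Sum.inr := by
    simp only [bdf2, map_add, map_sub, map_smul]
    rw [← hS.trace_eq hk (by omega), ← hS.trace_eq hk (by omega), ← hS.trace_eq hk (by omega)]
    rfl
  rw [hdelay, map_sub, map_smul, htrace]
  ext (i | i) <;> simp [lift, extend, bdf2]

theorem bulk_eq (hk : 1 ≤ k) (hS : D.IsSolution τ fu fp u p lam) {m : ℤ} (hm : 1 ≤ m) :
    D.Mu *ᵥ (bdf2 τ u m - (3 / (2 * τ)) • D.lift (bdiff (bdiff (bdiff p)) m)) +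
      D.Ku *ᵥ (u m - D.lift (bdiff (bdiff p) m)) = fu m + D.extend (D.Mlam *ᵥ lam m) := by
  rw [← hS.sumElim_eq_sub_lift hk hm, ← hS.sumElim_bdf2_eq_sub_lift hk hm, mulVec_sumElim,
    mulVec_sumElim, ← Sum.elim_comp_inl_inr (fu m), extend, ← Sum.elim_add_add, ← Sum.elim_add_add]
  simp only [traceProj_apply]
  congr 1
  · linear_combination (exp := 1) hS.eq_interior m hm
  · linear_combination (exp := 1) hS.eq_multiplier m hm

theorem tested (hk : 1 ≤ k) (hS : D.IsSolution τ fu fp u p lam) {m : ℤ} (hm : 1 ≤ m) :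
    bdiff u m ⬝ᵥ D.Mu *ᵥ bdf2 τ u m + bdiff u m ⬝ᵥ D.Ku *ᵥ u m +
      bdiff p m ⬝ᵥ D.Mp *ᵥ bdf2 τ p m + bdiff p m ⬝ᵥ D.Kp *ᵥ p m =
    bdiff u m ⬝ᵥ fu m + bdiff p m ⬝ᵥ fp m +
      3 / (2 * τ) * (bdiff u m ⬝ᵥ D.Mu *ᵥ D.lift (bdiff (bdiff (bdiff p)) m)) +
      bdiff u m ⬝ᵥ D.Ku *ᵥ D.lift (bdiff (bdiff p) m) := by
  have hbulk := congrArg (bdiff u m ⬝ᵥ ·) (hS.bulk_eq hk hm)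
  have hsurface := congrArg (bdiff p m ⬝ᵥ ·) (hS.eq_surface m hm)
  simp only [mulVec_sub, mulVec_smul, dotProduct_add, dotProduct_sub, dotProduct_smul, smul_eq_mul,
    D.dotProduct_extend_of_trace_eq (hS.trace_bdiff_eq hk hm)] at hbulk hsurface
  linarith

end IsSolution

/-! ### The energy estimate -/

/-- The discrete energy after `m` steps.  With `c = c_M h`, its value at `m = 0` is the contribution
of the initial data to `dataBound`. -/
noncomputable def stepEnergy (c τ : ℝ) (u : ℤ → Fin D.NI ⊕ Fin D.NB → ℝ) (p : ℤ → Fin D.Np → ℝ)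
    (m : ℤ) : ℝ :=
  sqNorm D.Ku (u m) + sqNorm D.Kp (p m) +
    τ / 2 * (sqNorm D.Mu (τ⁻¹ • bdiff u m) + sqNorm D.Mp (τ⁻¹ • bdiff p m)) +
    9 * c * τ * sqNorm D.Mp (τ⁻¹ • bdiff (bdiff p) m)

/-- The energy dissipated in step `m`, less what the extrapolation of `p` may produce; here
`c = c_M h` and `b = c_K / h`. -/
noncomputable def stepDissipation (c b τ : ℝ) (u : ℤ → Fin D.NI ⊕ Fin D.NB → ℝ)
    (p : ℤ → Fin D.Np → ℝ) (m : ℤ) : ℝ :=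
  τ * (sqNorm D.Mu (τ⁻¹ • bdiff u m) + sqNorm D.Mp (τ⁻¹ • bdiff p m) +
      1 / 2 * sqNorm D.Mu (τ⁻¹ • bdiff (bdiff u) m)) +
    sqNorm D.Kp (bdiff p m) +
    τ * ((1 / 2 - 18 * c - b * τ) * sqNorm D.Mp (τ⁻¹ • bdiff (bdiff p) m))

theorem energy_add_sum_le (hk : 1 ≤ k) {c b τ : ℝ} (hc : 0 ≤ c) (hτ : 0 ≤ τ)
    (u : ℤ → Fin D.NI ⊕ Fin D.NB → ℝ) (p : ℤ → Fin D.Np → ℝ) (m : ℤ) :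
    D.energy τ u p m +
      τ * ∑ j ∈ Finset.Icc 1 m, (1 / 2 - 18 * c - b * τ) * sqNorm D.Mp (τ⁻¹ • bdiff (bdiff p) j) ≤
    D.stepEnergy c τ u p m + ∑ j ∈ Finset.Icc 1 m, D.stepDissipation c b τ u p j := by
  have hu := sqNorm_nonneg (D.posDef_Mu hk).posSemidef (τ⁻¹ • bdiff u m)
  have hp := sqNorm_nonneg D.posDef_Mp.posSemidef (τ⁻¹ • bdiff p m)
  have hpp := sqNorm_nonneg D.posDef_Mp.posSemidef (τ⁻¹ • bdiff (bdiff p) m)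
  have hnonneg : 0 ≤ τ / 2 * (sqNorm D.Mu (τ⁻¹ • bdiff u m) + sqNorm D.Mp (τ⁻¹ • bdiff p m)) +
      9 * c * τ * sqNorm D.Mp (τ⁻¹ • bdiff (bdiff p) m) := by positivity
  simp only [energy, stepEnergy, stepDissipation, Finset.sum_add_distrib, ← Finset.mul_sum]
  linarith

namespace IsSolution

variable {D} {τ : ℝ} {fu : ℤ → Fin D.NI ⊕ Fin D.NB → ℝ} {fp : ℤ → Fin D.Np → ℝ}
  {u : ℤ → Fin D.NI ⊕ Fin D.NB → ℝ} {p : ℤ → Fin D.Np → ℝ} {lam : ℤ → Fin D.NB → ℝ}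

theorem two_mul_mass_perturbation_le (hk : 1 ≤ k) (hτ : 0 < τ) {c : ℝ}
    (hc : ∀ q, sqNorm D.Mu (D.lift q) ≤ c * sqNorm D.Mp q) (x : Fin D.NI ⊕ Fin D.NB → ℝ)
    (q q' : Fin D.Np → ℝ) :
    2 * (3 / (2 * τ) * (x ⬝ᵥ D.Mu *ᵥ D.lift (q - q'))) ≤
      τ * (1 / 2 * sqNorm D.Mu (τ⁻¹ • x) +
        9 * c * (sqNorm D.Mp (τ⁻¹ • q) + sqNorm D.Mp (τ⁻¹ • q'))) := by
  rw [map_sub]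
  refine (two_mul_dotProduct_mulVec_sub_le (D.posDef_Mu hk).posSemidef hτ _ _ _).trans ?_
  rw [← map_smul, ← map_smul]
  gcongr τ * (_ + ?_)
  linarith [hc (τ⁻¹ • q), hc (τ⁻¹ • q')]

theorem two_mul_stiffness_perturbation_le (hτ : τ ≠ 0) {b : ℝ}
    (hb : ∀ q, sqNorm D.Ku (D.lift q) ≤ b * sqNorm D.Mp q) (x : Fin D.NI ⊕ Fin D.NB → ℝ)
    (q : Fin D.Np → ℝ) :
    2 * (x ⬝ᵥ D.Ku *ᵥ D.lift q) ≤ sqNorm D.Ku x + τ * (b * τ * sqNorm D.Mp (τ⁻¹ • q)) := by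
  have hscale : τ * (b * τ * sqNorm D.Mp (τ⁻¹ • q)) = b * sqNorm D.Mp q := by
    rw [sqNorm_smul]
    field_simp
  rw [hscale]
  exact (two_mul_dotProduct_mulVec_le D.posSemidef_Ku x _).trans (add_le_add_right (hb q) _)

theorem stepEnergy_add_stepDissipation_le (hk : 1 ≤ k) (hτ : 0 < τ) {c b : ℝ}
    (hc : ∀ q, sqNorm D.Mu (D.lift q) ≤ c * sqNorm D.Mp q)
    (hb : ∀ q, sqNorm D.Ku (D.lift q) ≤ b * sqNorm D.Mp q)
    (hS : D.IsSolution τ fu fp u p lam) {m : ℤ} (hm : 1 ≤ m) :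
    D.stepEnergy c τ u p m + D.stepDissipation c b τ u p m ≤ D.stepEnergy c τ u p (m - 1) +
      2 * τ * (sqNorm D.Mu⁻¹ (fu m) + sqNorm D.Mp⁻¹ (fp m)) := by
  have hMu := D.posDef_Mu hk
  have hMp := D.posDef_Mp
  have htested := hS.tested hk hm
  have hMu_bdf2 := two_mul_dotProduct_mulVec_bdf2 hMu.isHermitian hτ.ne' u m
  have hMp_bdf2 := two_mul_dotProduct_mulVec_bdf2 hMp.isHermitian hτ.ne' p m
  have hKu_bdiff := two_mul_dotProduct_mulVec_bdiff D.posSemidef_Ku.isHermitian u m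
  have hKp_bdiff := two_mul_dotProduct_mulVec_bdiff D.isHermitian_Kp p m
  have hload_u := two_mul_dotProduct_le hMu hτ (bdiff u m) (fu m)
  have hload_p := two_mul_dotProduct_le hMp hτ (bdiff p m) (fp m)
  have hmass := two_mul_mass_perturbation_le hk hτ hc (bdiff u m) (bdiff (bdiff p) m)
    (bdiff (bdiff p) (m - 1))
  have hstiff := two_mul_stiffness_perturbation_le hτ.ne' hb (bdiff u m) (bdiff (bdiff p) m)
  have hp := mul_nonneg hτ.le (sqNorm_nonneg hMp.posSemidef (τ⁻¹ • bdiff p m))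
  rw [← bdiff] at hmass
  simp only [stepEnergy, stepDissipation]
  linarith

theorem stepEnergy_add_sum_stepDissipation_le (hk : 1 ≤ k) (hτ : 0 < τ) {c b : ℝ}
    (hc : ∀ q, sqNorm D.Mu (D.lift q) ≤ c * sqNorm D.Mp q)
    (hb : ∀ q, sqNorm D.Ku (D.lift q) ≤ b * sqNorm D.Mp q)
    (hS : D.IsSolution τ fu fp u p lam) {m : ℤ} (hm : 0 ≤ m) :
    D.stepEnergy c τ u p m + ∑ j ∈ Finset.Icc 1 m, D.stepDissipation c b τ u p j ≤
      D.stepEnergy c τ u p 0 +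
        2 * τ * ∑ j ∈ Finset.Icc 1 m, (sqNorm D.Mu⁻¹ (fu j) + sqNorm D.Mp⁻¹ (fp j)) := by
  induction m, hm using Int.leInduction with
  | base => simp
  | succ m hm ih =>
    have hstep := hS.stepEnergy_add_stepDissipation_le hk hτ hc hb (show 1 ≤ m + 1 by omega)
    have hIcc : Finset.Icc 1 (m + 1) = insert (m + 1) (Finset.Icc 1 m) := by
      ext j
      simp only [Finset.mem_Icc, Finset.mem_insert]
      omega
    have hnotMem : m + 1 ∉ Finset.Icc 1 m := by simp
    rw [add_sub_cancel_right] at hstep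
    rw [hIcc, Finset.sum_insert hnotMem, Finset.sum_insert hnotMem]
    linarith

theorem energy_add_sum_le_dataBound (hk : 1 ≤ k) (hτ : 0 < τ) {cM cK : ℝ} (hcM : 0 ≤ cM)
    (hM : ∀ q, sqNorm D.Mu (D.lift q) ≤ cM * D.h * sqNorm D.Mp q)
    (hK : ∀ q, sqNorm D.Ku (D.lift q) ≤ cK * D.h⁻¹ * sqNorm D.Mp q)
    (hS : D.IsSolution τ fu fp u p lam) {m : ℤ} (hm : 0 ≤ m) :
    D.energy τ u p m + τ * ∑ j ∈ Finset.Icc 1 m, (1 / 2 - 18 * cM * D.h - cK * τ * D.h⁻¹) *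
      sqNorm D.Mp (τ⁻¹ • bdiff (bdiff p) j) ≤ D.dataBound cM τ fu fp u p m := by
  have hcoeff : 1 / 2 - 18 * cM * D.h - cK * τ * D.h⁻¹ =
      1 / 2 - 18 * (cM * D.h) - cK * D.h⁻¹ * τ := by ring
  rw [hcoeff]
  refine (D.energy_add_sum_le hk (mul_nonneg hcM D.h_nonneg) hτ.le u p m).trans
    ((hS.stepEnergy_add_sum_stepDissipation_le hk hτ hM hK hm).trans_eq ?_)
  simp only [stepEnergy, dataBound]
  ring

end IsSolution

theorem sqNorm_extend_le_sqNorm_Mp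
    {A : Matrix (Fin D.NI ⊕ Fin D.NB) (Fin D.NI ⊕ Fin D.NB) ℝ} {c : ℝ} (hc : 0 ≤ c)
    (hA : ∀ w, sqNorm A (D.extend w) ≤ c * sqNorm D.Mlam w) {w : Fin D.NB → ℝ}
    {p : Fin D.Np → ℝ} (hwp : D.Mlam *ᵥ w = D.Bp *ᵥ p) :
    sqNorm A (D.extend w) ≤ c * sqNorm D.Mp p :=
  (hA w).trans (mul_le_mul_of_nonneg_left (D.sqNorm_Mlam_le_sqNorm_Mp hwp) hc)

end BulkSurfaceFE

theorem coeff_nonneg_of_le {cM cK h τ : ℝ} (hcM : 0 < cM) (hcK : 0 < cK) (hτ : 0 < τ)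
    (hh : h ≤ 1 / (72 * cM)) (hτh : τ ≤ 1 / (4 * cK) * h) :
    0 ≤ 1 / 2 - 18 * cM * h - cK * τ * h⁻¹ := by
  have hpos : 0 < h := pos_of_mul_pos_right (hτ.trans_le hτh) (by positivity)
  have hmass : 18 * cM * h ≤ 1 / 4 := by
    calc 18 * cM * h ≤ 18 * cM * (1 / (72 * cM)) := by gcongr
      _ = 1 / 4 := by field_simp; norm_num
  have hstiff : cK * τ * h⁻¹ ≤ 1 / 4 := by
    calc cK * τ * h⁻¹ ≤ cK * (1 / (4 * cK) * h) * h⁻¹ := by gcongr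
      _ = 1 / 4 := by field_simp
  linarith

theorem mainTheorem4_general (d k : ℕ) (hd : 1 ≤ d) (hk : 1 ≤ k) (σ : ℝ) (hσ : 0 < σ) :
    ∃ cM > 0, ∀ αmax > 0, ∃ cK > 0, ∃ h₀ > 0, ∃ C > 0,
      ∀ D : BulkSurfaceFE d k, D.QuasiUniform σ →
        (∀ᵐ x ∂(volume.restrict D.Ω), D.α x ≤ αmax) →
        (∀ (u : Fin D.NI ⊕ Fin D.NB → ℝ) (p : Fin D.Np → ℝ), D.Bu *ᵥ u = D.Bp *ᵥ p →
          sqNorm D.Mu.toBlocks₂₂ (u ∘ Sum.inr) ≤ cM * D.h * sqNorm D.Mp p ∧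
          sqNorm D.Ku.toBlocks₂₂ (u ∘ Sum.inr) ≤ cK * D.h⁻¹ * sqNorm D.Mp p) ∧
        (∀ (τ : ℝ), 0 < τ →
          ∀ (fu : ℤ → Fin D.NI ⊕ Fin D.NB → ℝ) (fp : ℤ → Fin D.Np → ℝ)
            (u : ℤ → Fin D.NI ⊕ Fin D.NB → ℝ) (p : ℤ → Fin D.Np → ℝ) (lam : ℤ → Fin D.NB → ℝ),
          D.IsSolution τ fu fp u p lam →
          ∀ n : ℤ, -2 ≤ n →
            D.energy τ u p (n + 3)
              + τ * ∑ j ∈ Finset.Icc 1 (n + 3),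
                  (1 / 2 - 18 * cM * D.h - cK * τ * D.h⁻¹)
                    * sqNorm D.Mp (τ⁻¹ • bdiff (bdiff p) j)
              ≤ D.dataBound cM τ fu fp u p (n + 3) ∧
            (D.h ≤ h₀ → τ ≤ C * D.h →
              0 ≤ 1 / 2 - 18 * cM * D.h - cK * τ * D.h⁻¹ ∧
              D.energy τ u p (n + 3) ≤ D.dataBound cM τ fu fp u p (n + 3))) := by
  obtain ⟨n, rfl⟩ : ∃ n, d = n + 1 := ⟨d - 1, by omega⟩
  obtain ⟨cM, hcM, hM⟩ := BulkSurfaceFE.exists_sqNorm_Mu_extend_le n hk hσ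
  refine ⟨cM, hcM, fun αmax hα => ?_⟩
  obtain ⟨cK, hcK, hK⟩ := BulkSurfaceFE.exists_sqNorm_Ku_extend_le n hk hσ hα
  refine ⟨cK, hcK, 1 / (72 * cM), by positivity, 1 / (4 * cK), by positivity,
    fun D hD hDα => ?_⟩
  have hMu {w p} (hwp : D.Mlam *ᵥ w = D.Bp *ᵥ p) := D.sqNorm_extend_le_sqNorm_Mp
    (mul_nonneg hcM.le D.h_nonneg) (hM D hD) hwp
  have hKu {w p} (hwp : D.Mlam *ᵥ w = D.Bp *ᵥ p) := D.sqNorm_extend_le_sqNorm_Mp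
    (mul_nonneg hcK.le (inv_nonneg.2 D.h_nonneg)) (hK D hD hDα) hwp
  refine ⟨fun u p hup => ?_, fun τ hτ fu fp u p lam hS n hn => ?_⟩
  · rw [D.Bu_mulVec hk] at hup
    rw [D.sqNorm_toBlocks₂₂, D.sqNorm_toBlocks₂₂]
    exact ⟨hMu hup, hKu hup⟩
  · have hbound := hS.energy_add_sum_le_dataBound hk hτ hcM.le
      (fun q => hMu (D.Mlam_mulVec_traceProj q)) (fun q => hKu (D.Mlam_mulVec_traceProj q))
      (show 0 ≤ n + 3 by omega)
    refine ⟨hbound, fun hh hτh => ?_⟩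
    have hcoeff := coeff_nonneg_of_le hcM hcK hτ hh hτh
    exact ⟨hcoeff, (le_add_of_nonneg_right (mul_nonneg hτ.le (Finset.sum_nonneg fun j _ =>
      mul_nonneg hcoeff (sqNorm_nonneg D.posDef_Mp.posSemidef _)))).trans hbound⟩

theorem mainTheorem4 (d k : ℕ) (hd : d = 2 ∨ d = 3) (hk : 1 ≤ k) (σ : ℝ) (hσ : 0 < σ) :
    ∃ cM > 0, ∀ αmax > 0, ∃ cK > 0, ∃ h₀ > 0, ∃ C > 0,
      ∀ D : BulkSurfaceFE d k, D.QuasiUniform σ →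
        (∀ᵐ x ∂(volume.restrict D.Ω), D.α x ≤ αmax) →
        (∀ (u : Fin D.NI ⊕ Fin D.NB → ℝ) (p : Fin D.Np → ℝ), D.Bu *ᵥ u = D.Bp *ᵥ p →
          sqNorm D.Mu.toBlocks₂₂ (u ∘ Sum.inr) ≤ cM * D.h * sqNorm D.Mp p ∧
          sqNorm D.Ku.toBlocks₂₂ (u ∘ Sum.inr) ≤ cK * D.h⁻¹ * sqNorm D.Mp p) ∧
        (∀ (τ : ℝ), 0 < τ →
          ∀ (fu : ℤ → Fin D.NI ⊕ Fin D.NB → ℝ) (fp : ℤ → Fin D.Np → ℝ)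
            (u : ℤ → Fin D.NI ⊕ Fin D.NB → ℝ) (p : ℤ → Fin D.Np → ℝ) (lam : ℤ → Fin D.NB → ℝ),
          D.IsSolution τ fu fp u p lam →
          ∀ n : ℤ, -2 ≤ n →
            D.energy τ u p (n + 3)
              + τ * ∑ j ∈ Finset.Icc 1 (n + 3),
                  (1 / 2 - 18 * cM * D.h - cK * τ * D.h⁻¹)
                    * sqNorm D.Mp (τ⁻¹ • bdiff (bdiff p) j)
              ≤ D.dataBound cM τ fu fp u p (n + 3) ∧
            (D.h ≤ h₀ → τ ≤ C * D.h →
              0 ≤ 1 / 2 - 18 * cM * D.h - cK * τ * D.h⁻¹ ∧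
              D.energy τ u p (n + 3) ≤ D.dataBound cM τ fu fp u p (n + 3))) :=
  mainTheorem4_general d k (by omega) hk σ hσ
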